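/- Consider, for each $n = N_{\mathrm a}\ge 1$, a network of $n$ agents whose positions $p_1,\dots,p_n$ form a binomial point process on a measurable region $\mathcal R_n\subset\mathbb R^2$, i.e. they are independent and uniformly distributed on $\mathcal R_n$. The network is an extended one: the intensity $\lambda_{\mathrm a}=n/|\mathcal R_n|>0$ does not depend on $n$, and the regions grow in all directions, in the sense that for some constant $c>0$ each $\mathcal R_n$ contains a disc of radius $c\sqrt n$. Two distinct agents are neighbours if and only if their distance is at most a fixed communication range $R_{\max}>0$; there are no reference nodes. The agents have clock offsets $\theta_1,\dots,\theta_n$. For every ordered pair $(i,j)$ of neighbours there are $N\ge1$ observations $\tau_{ij}^{(m)}=2(\theta_j-\theta_i)+\nu_{ij}^{(m)}$ with independent noises $\nu_{ij}^{(m)}\sim\mathcal N(0,\sigma^2)$, $\sigma^2>0$. A subset of the agents has a priori information: the offset of such an agent $k$ has a differentiable prior density $f_k$ on $\mathbb R$, independently of the others, and its amount of a priori information is the Fisher information $\xi_{\mathrm P,k}=\mathbb E\{((\ln f_k)'(\theta_k))^2\}$. The offsets of the other agents are unknown constants. Which agents have a priori information, and which priors they have, does not depend on the positions, so that the agents with a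 priori information form a binomial point process on $\mathcal R_n$; its intensity (their number divided by $|\mathcal R_n|$) is a fixed $\lambda_{\mathrm{ap}}>0$, up to rounding to an integer number of agents, that is, it tends to $\lambda_{\mathrm{ap}}$ as $n\to\infty$. Assume that $\xi_{\min}\le\xi_{\mathrm P,k}\le\xi_{\max}$ for every agent $k$ with a priori information, where $0<\xi_{\min}\le\xi_{\max}$ do not depend on $n$. Given the positions, let $f(\tau,\theta)$ be the joint density of observations and offsets (the product of the Gaussian likelihoods and of the prior densities), let $J=\mathbb E\{[\nabla_\theta\ln f(\tau,\theta)][\nabla_\theta\ln f(\tau,\theta)]^{\mathsf T}\}$ be the Fisher information matrix, and let $s(\theta_i)=[J^{-1}]_{i,i}$ be the absolute synchronization error bound of agent $i$ (with $s(\theta_i)=\infty$ if $J$ is singular). Then the expected average absolute synchronization error bound, taken over the random positions given that the network is connected, satisfies $$\mathbb E\Big\{\frac1n\sum_{i=1}^{n}s(\theta_i)\;\Big|\;\text{the network is connected}\Big\}=\Theta(1)\qquad (n\to\infty),$$ i.e. its limit inferior is positive and its limit superior is finite. -/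

import Mathlib

open MeasureTheory ProbabilityTheory Filter Topology
open scoped ENNReal NNReal

noncomputable section

namespace NetworkSync

/-- The Euclidean plane, in which the network is embedded. -/
abbrev Plane : Type := EuclideanSpace ℝ (Fin 2)

/-- The communication graph of agents located at `p i`: two distinct agents are neighbours iff
their Euclidean distance is at most the maximum communication range `Rmax`. -/
def commGraph {ι : Type*} (Rmax : ℝ) (p : ι → Plane) : SimpleGraph ι :=
  SimpleGraph.fromRel fun i j => dist (p i) (p j) ≤ Rmax

/-- The binomial point process with `n` points on the region `R`: the joint law of `n` independent
points, each uniformly distributed on `R`. -/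
def binomialProcess (n : ℕ) (R : Set Plane) : Measure (Fin n → Plane) :=
  Measure.pi fun _ => volume[|R]

/-- A (regular) prior probability density of a clock offset. -/
structure PriorDensity where
  /-- the density function -/
  pdf : ℝ → ℝ
  nonneg : ∀ x, 0 ≤ pdf x
  differentiable : Differentiable ℝ pdf
  integral_eq_one : ∫ x, pdf x = 1

/-- The prior distribution with the given density. -/
def PriorDensity.law (f : PriorDensity) : Measure ℝ :=
  volume.withDensity fun x => ENNReal.ofReal (f.pdf x)

/-- The amount of a priori information: the Fisher information `E[((ln f)'(θ))²]` of the prior.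
It is only ever required to lie between positive bounds, which forces the integral to exist. -/
def PriorDensity.information (f : PriorDensity) : ℝ :=
  ∫ x, deriv (fun y => Real.log (f.pdf y)) x ^ 2 ∂f.law

section FIM

variable {ι : Type*} [Fintype ι]

open scoped Classical in
/-- The index set of the timing observations: `N` rounds for every ordered pair of neighbours. -/
abbrev ObsIndex (G : SimpleGraph ι) (N : ℕ) : Type _ := G.Dart × Fin N

/-- The mean `2 (θ_j - θ_i)` of an observation that node `i` collects on the link `(i, j)`. -/
def obsMean {G : SimpleGraph ι} {N : ℕ} (θ : ι → ℝ) (e : ObsIndex G N) : ℝ :=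
  2 * (θ e.1.snd - θ e.1.fst)

open scoped Classical in
/-- The law of the observations given the clock offsets `θ`: independent Gaussians
`τ_{ij}^{(n)} ∼ N(2 (θ_j - θ_i), v)`, where `v = σ²` is the noise variance. -/
def obsLaw (G : SimpleGraph ι) (N : ℕ) (v : ℝ≥0) (θ : ι → ℝ) : Measure (ObsIndex G N → ℝ) :=
  Measure.pi fun e => gaussianReal (obsMean θ e) v

/-- The factor that the prior of an agent contributes to the joint density; an agent without
a priori information (`none`) contributes nothing. -/
def priorFactor : Option PriorDensity → ℝ → ℝ
  | none, _ => 1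
  | some f, x => f.pdf x

open scoped Classical in
/-- The joint density of observations and clock offsets. -/
def jointDensity (G : SimpleGraph ι) (N : ℕ) (v : ℝ≥0) (prior : ι → Option PriorDensity)
    (τ : ObsIndex G N → ℝ) (θ : ι → ℝ) : ℝ :=
  (∏ k, priorFactor (prior k) (θ k)) * ∏ e, gaussianPDFReal (obsMean θ e) v (τ e)

open scoped Classical in
/-- The `i`-th entry of the score `∇_θ ln f(τ, θ)`. -/
def score (G : SimpleGraph ι) (N : ℕ) (v : ℝ≥0) (prior : ι → Option PriorDensity)
    (τ : ObsIndex G N → ℝ) (θ : ι → ℝ) (i : ι) : ℝ :=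
  deriv (fun t => Real.log (jointDensity G N v prior τ (Function.update θ i t))) (θ i)

/-- The law of the clock offsets: independent, `θ_k` distributed according to the prior of agent
`k`; the offset of an agent without a priori information is an unknown constant `θ₀ k`. -/
def offsetLaw (prior : ι → Option PriorDensity) (θ₀ : ι → ℝ) : Measure (ι → ℝ) :=
  Measure.pi fun k =>
    match prior k with
    | none => Measure.dirac (θ₀ k)
    | some f => f.law

/-- The Fisher information matrix `J = E[(∇_θ ln f(τ, θ)) (∇_θ ln f(τ, θ))ᵀ]` of the absolute
synchronization problem on the network with communication graph `G`. -/
def fim (G : SimpleGraph ι) (N : ℕ) (v : ℝ≥0) (prior : ι → Option PriorDensity) (θ₀ : ι → ℝ) :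
    Matrix ι ι ℝ :=
  Matrix.of fun i j =>
    ∫ θ, (∫ τ, score G N v prior τ θ i * score G N v prior τ θ j ∂obsLaw G N v θ)
      ∂offsetLaw prior θ₀

open scoped Classical in
/-- The absolute synchronization error bound `[J⁻¹]_{i,i}` of agent `i`; it is `∞` when `J` is
singular, i.e. when the network is not able to perform absolute synchronization. -/
def aseb (J : Matrix ι ι ℝ) (i : ι) : ℝ≥0∞ :=
  if IsUnit J.det then ENNReal.ofReal (J⁻¹ i i) else ⊤

end FIM

/-- The expected average absolute synchronization error bound `E[n⁻¹ ∑ i, s(θ_i)]` of a network of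
`n` agents that form a binomial point process on `R`, given that the network is connected. -/
def expectedAverageASEB (n : ℕ) (R : Set Plane) (Rmax : ℝ) (N : ℕ) (v : ℝ≥0)
    (prior : Fin n → Option PriorDensity) (θ₀ : Fin n → ℝ) : ℝ≥0∞ :=
  ∫⁻ p, (∑ i, aseb (fim (commGraph Rmax p) N v prior θ₀) i) / n
    ∂(binomialProcess n R)[|{p | (commGraph Rmax p).Connected}]

end NetworkSync

end

/-! The Fisher information matrix J is a weighted graph Laplacian plus the diagonal of prior
informations (`fim_apply`), so its quadratic form is the energy of a resistor network in which each
prior is a conductance to ground. Both bounds come from this form.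

Upper bound: s(θ_i) is at most the resistance of a path from i to an agent with a prior
(`aseb_fim_le`), hence linear in the graph distance to the set A of such agents. The law of the
positions is exchangeable, so A may be replaced by an average over all k-subsets, k = |A|, with the
connected graph held fixed. A ball of radius r < n in a connected graph has more than r vertices, so
few k-subsets miss it; summing over r gives mean distance at most C(n,k+1)/C(n,k) ≤ n/k
(`sum_depth_le`, `card_mul_lintegral_totalDepth_le`). This ratio stays bounded, and the probability
of connectivity cancels.

Lower bound: s(θ_i) ≥ 1/J_ii, and J_ii is controlled by the degree of i (`le_aseb`, `fim_diag_le`).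
Connectivity may be exponentially unlikely, so crowding has to be excluded at an exponential scale.
Connectivity has probability at least δ^n (`exists_pow_le_measure_connected`). For small ε, the
event that half of the agents lie ε-close to an earlier one has probability at most (δ/2)^n
(`measure_followers_le`). Otherwise at least half of the agents are ε-separated, and a packing bound
controls their average degree (`le_sum_aseb_of_followers`). -/

noncomputable section

namespace NetworkSync

/-! ### Second moments of independent centred variables. -/

section ProductMeasure

variable {ι : Type*} [Fintype ι]

lemma integrable_pi_eval_mul_eval {μ : ι → Measure ℝ} [∀ i, IsProbabilityMeasure (μ i)]
    {Z : ι → ℝ → ℝ} (hZ : ∀ i, MemLp (Z i) 2 (μ i)) (i j : ι) :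
    Integrable (fun x : ι → ℝ => Z i (x i) * Z j (x j)) (Measure.pi μ) :=
  MemLp.integrable_mul ((hZ i).comp_measurePreserving (measurePreserving_eval μ i))
    ((hZ j).comp_measurePreserving (measurePreserving_eval μ j))

lemma integral_pi_eval_mul_eval [DecidableEq ι] {μ : ι → Measure ℝ}
    [∀ i, IsProbabilityMeasure (μ i)] {Z : ι → ℝ → ℝ} (hZ : ∀ i, MemLp (Z i) 2 (μ i))
    (hZ0 : ∀ i, ∫ x, Z i x ∂μ i = 0) (i j : ι) :
    ∫ x, Z i (x i) * Z j (x j) ∂Measure.pi μ = if i = j then ∫ x, Z i x ^ 2 ∂μ i else 0 := by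
  split_ifs with h
  · subst h
    simp_rw [← sq]
    exact integral_comp_eval (μ := μ) (f := fun y => Z i y ^ 2) ((hZ i).1.pow 2)
  · have hind := (iIndepFun_pi (μ := μ) (X := Z) fun i => (hZ i).1.aemeasurable).indepFun h
    have h1 : ∀ k, AEStronglyMeasurable (fun x : ι → ℝ => Z k (x k)) (Measure.pi μ) := fun k =>
      ((hZ k).comp_measurePreserving (measurePreserving_eval μ k)).1
    rw [hind.integral_fun_mul_eq_mul_integral (h1 i) (h1 j),
      integral_comp_eval (μ := μ) (f := Z i) (hZ i).1, hZ0, zero_mul]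

/-- Independence and centring kill every cross term. With the prior scores in the role of the
constants a and b, this is the conditional expectation of a product of two scores given the offsets.
-/
lemma integral_pi_affine_mul_affine {μ : ι → Measure ℝ}
    [∀ i, IsProbabilityMeasure (μ i)] {Z : ι → ℝ → ℝ} (hZ : ∀ i, MemLp (Z i) 2 (μ i))
    (hZ0 : ∀ i, ∫ x, Z i x ∂μ i = 0) (a b : ℝ) (c d : ι → ℝ) :
    ∫ x, (a + ∑ i, c i * Z i (x i)) * (b + ∑ i, d i * Z i (x i)) ∂Measure.pi μ =
      a * b + ∑ i, c i * d i * ∫ x, Z i x ^ 2 ∂μ i := by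
  classical
  have hL : ∀ i, MemLp (fun x : ι → ℝ => Z i (x i)) 2 (Measure.pi μ) := fun i =>
    (hZ i).comp_measurePreserving (measurePreserving_eval μ i)
  have h1 : ∀ i, Integrable (fun x : ι → ℝ => Z i (x i)) (Measure.pi μ) := fun i =>
    (hL i).integrable (by norm_num)
  have h0 : ∀ i, ∫ x : ι → ℝ, Z i (x i) ∂Measure.pi μ = 0 := fun i => by
    rw [integral_comp_eval (μ := μ) (f := Z i) (hZ i).1, hZ0]
  have hS : ∀ c : ι → ℝ, Integrable (fun x : ι → ℝ => ∑ i, c i * Z i (x i)) (Measure.pi μ) :=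
    fun c => integrable_finsetSum _ fun i _ => (h1 i).const_mul _
  have hS0 : ∀ c : ι → ℝ, ∫ x : ι → ℝ, ∑ i, c i * Z i (x i) ∂Measure.pi μ = 0 := fun c => by
    rw [integral_finsetSum _ fun i _ => (h1 i).const_mul _]
    simp [integral_const_mul, h0]
  have hexp : ∀ x : ι → ℝ, (a + ∑ i, c i * Z i (x i)) * (b + ∑ i, d i * Z i (x i)) =
      (a * b + a * ∑ i, d i * Z i (x i) + b * ∑ i, c i * Z i (x i)) +
        ∑ i, ∑ j, c i * d j * (Z i (x i) * Z j (x j)) := fun x => by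
    rw [add_mul, mul_add, mul_add, Finset.sum_mul_sum]
    have : ∀ i j, c i * Z i (x i) * (d j * Z j (x j)) = c i * d j * (Z i (x i) * Z j (x j)) :=
      fun i j => by ring
    simp_rw [this]
    ring
  have hI : ∀ i j, Integrable (fun x : ι → ℝ => c i * d j * (Z i (x i) * Z j (x j)))
      (Measure.pi μ) := fun i j => (integrable_pi_eval_mul_eval hZ i j).const_mul _
  simp_rw [hexp]
  rw [integral_add, integral_add, integral_add, integral_const_mul b,
    integral_const_mul a (fun x : ι → ℝ => ∑ i, d i * Z i (x i)), hS0, hS0, integral_finsetSum]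
  · simp_rw [integral_finsetSum _ fun j _ => hI _ j, integral_const_mul,
      integral_pi_eval_mul_eval hZ hZ0]
    simp
  · exact fun i _ => integrable_finsetSum _ fun j _ => hI i j
  · exact integrable_const _
  · exact (hS d).const_mul _
  · exact (integrable_const _).add ((hS d).const_mul _)
  · exact (hS c).const_mul _
  · exact ((integrable_const _).add ((hS d).const_mul _)).add ((hS c).const_mul _)
  · exact integrable_finsetSum _ fun i _ => integrable_finsetSum _ fun j _ => hI i j

end ProductMeasure

/-! ### Scores of the priors. -/

section Prior

lemma PriorDensity.integrable (f : PriorDensity) : Integrable f.pdf := by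
  by_contra h
  have := integral_undef h
  rw [f.integral_eq_one] at this
  exact one_ne_zero this

instance (f : PriorDensity) : IsProbabilityMeasure f.law := by
  refine ⟨?_⟩
  rw [PriorDensity.law, withDensity_apply _ MeasurableSet.univ, Measure.restrict_univ,
    ← ofReal_integral_eq_lintegral_ofReal f.integrable (ae_of_all _ f.nonneg), f.integral_eq_one,
    ENNReal.ofReal_one]

lemma PriorDensity.ae_pos (f : PriorDensity) : ∀ᵐ x ∂f.law, 0 < f.pdf x := by
  rw [PriorDensity.law, ae_withDensity_iff f.differentiable.continuous.measurable.ennreal_ofReal]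
  refine ae_of_all _ fun x hx => ?_
  by_contra h
  exact hx (ENNReal.ofReal_of_nonpos (not_lt.1 h))

/-- A zero of a nonnegative function is a minimum. Hence f · (ln f)' = f' holds even at the zeros of
f, where the logarithm carries no meaning. -/
lemma PriorDensity.deriv_eq_zero (f : PriorDensity) {x : ℝ} (hx : f.pdf x = 0) :
    deriv f.pdf x = 0 :=
  IsLocalMin.deriv_eq_zero (Eventually.of_forall fun y => by rw [hx]; exact f.nonneg y)

lemma PriorDensity.pdf_mul_deriv_log (f : PriorDensity) (x : ℝ) :
    f.pdf x * deriv (fun y => Real.log (f.pdf y)) x = deriv f.pdf x := by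
  rcases eq_or_ne (f.pdf x) 0 with h | h
  · rw [h, zero_mul, f.deriv_eq_zero h]
  · rw [deriv.log (f.differentiable x) h, mul_div_cancel₀ _ h]

lemma PriorDensity.integral_law (f : PriorDensity) (g : ℝ → ℝ) :
    ∫ x, g x ∂f.law = ∫ x, f.pdf x * g x := by
  rw [PriorDensity.law, integral_withDensity_eq_integral_toReal_smul
    f.differentiable.continuous.measurable.ennreal_ofReal
    (ae_of_all _ fun x => ENNReal.ofReal_lt_top)]
  simp [ENNReal.toReal_ofReal (f.nonneg _)]

/-- A non-integrable square would have Bochner integral 0, so nonzero information already contains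
the integrability. -/
lemma PriorDensity.memLp_deriv_log (f : PriorDensity) (hf : f.information ≠ 0) :
    MemLp (deriv fun y => Real.log (f.pdf y)) 2 f.law := by
  rw [memLp_two_iff_integrable_sq (measurable_deriv _).aestronglyMeasurable]
  by_contra h
  exact hf (integral_undef h)

/-- The integral is that of f' over the line. It vanishes because f and f' are both integrable, the
latter since a square-integrable score is integrable under the prior law. -/
lemma PriorDensity.integral_deriv_log (f : PriorDensity) (hf : f.information ≠ 0) :
    ∫ x, deriv (fun y => Real.log (f.pdf y)) x ∂f.law = 0 := by
  rw [f.integral_law]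
  simp_rw [f.pdf_mul_deriv_log]
  refine integral_eq_zero_of_hasDerivAt_of_integrable
    (fun x => (f.differentiable x).hasDerivAt) ?_ f.integrable
  have h := (f.memLp_deriv_log hf).integrable (by norm_num)
  rw [PriorDensity.law, integrable_withDensity_iff_integrable_smul'
    f.differentiable.continuous.measurable.ennreal_ofReal
    (ae_of_all _ fun x => ENNReal.ofReal_lt_top)] at h
  simpa [ENNReal.toReal_ofReal (f.nonneg _), f.pdf_mul_deriv_log] using h

/-- The amount of a priori information, `0` for an agent without a priori information. -/
def priorInfo : Option PriorDensity → ℝ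
  | none => 0
  | some f => f.information

/-- The logarithmic derivative of the prior factor. -/
def priorScore (o : Option PriorDensity) (x : ℝ) : ℝ :=
  deriv (fun y => Real.log (priorFactor o y)) x

/-- The law of a single clock offset. -/
def singleOffsetLaw (o : Option PriorDensity) (t : ℝ) : Measure ℝ :=
  match o with
  | none => Measure.dirac t
  | some f => f.law

instance (o : Option PriorDensity) (t : ℝ) : IsProbabilityMeasure (singleOffsetLaw o t) := by
  cases o <;> simp only [singleOffsetLaw] <;> infer_instance

lemma priorScore_none : priorScore none = fun _ => 0 := by
  ext x; simp [priorScore, priorFactor]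

lemma memLp_priorScore (o : Option PriorDensity) (t : ℝ) (h : ∀ f ∈ o, f.information ≠ 0) :
    MemLp (priorScore o) 2 (singleOffsetLaw o t) := by
  cases o with
  | none => rw [priorScore_none]; exact MemLp.zero'
  | some f => exact f.memLp_deriv_log (h f rfl)

lemma integral_priorScore (o : Option PriorDensity) (t : ℝ) (h : ∀ f ∈ o, f.information ≠ 0) :
    ∫ x, priorScore o x ∂singleOffsetLaw o t = 0 := by
  cases o with
  | none => simp [priorScore_none]
  | some f => exact f.integral_deriv_log (h f rfl)

lemma integral_priorScore_sq (o : Option PriorDensity) (t : ℝ) :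
    ∫ x, priorScore o x ^ 2 ∂singleOffsetLaw o t = priorInfo o := by
  cases o with
  | none => simp [priorScore_none, priorInfo]
  | some f => rfl

lemma ae_priorFactor_pos (o : Option PriorDensity) (t : ℝ) :
    ∀ᵐ x ∂singleOffsetLaw o t, 0 < priorFactor o x := by
  cases o with
  | none => simp [priorFactor]
  | some f => exact f.ae_pos

lemma differentiable_priorFactor (o : Option PriorDensity) :
    Differentiable ℝ (priorFactor o) := by
  cases o with
  | none => exact differentiable_const _
  | some f => exact f.differentiable

end Prior

/-! ### Moments and log-density of the Gaussian noise. -/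

section Gaussian

lemma memLp_sub_gaussianReal (m : ℝ) (v : ℝ≥0) :
    MemLp (fun x => x - m) 2 (gaussianReal m v) :=
  (memLp_id_gaussianReal 2).sub (memLp_const m)

lemma integral_sub_gaussianReal (m : ℝ) (v : ℝ≥0) : ∫ x, (x - m) ∂gaussianReal m v = 0 := by
  have : Integrable (fun x : ℝ => x) (gaussianReal m v) :=
    (memLp_id_gaussianReal 2).integrable (by norm_num)
  rw [integral_sub this (integrable_const _), integral_id_gaussianReal]
  simp

lemma integral_sub_sq_gaussianReal (m : ℝ) (v : ℝ≥0) :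
    ∫ x, (x - m) ^ 2 ∂gaussianReal m v = v := by
  have := variance_fun_id_gaussianReal (μ := m) (v := v)
  rwa [variance_eq_integral measurable_id'.aemeasurable, integral_id_gaussianReal] at this

lemma log_gaussianPDFReal {v : ℝ≥0} (hv : v ≠ 0) (m x : ℝ) :
    Real.log (gaussianPDFReal m v x) =
      Real.log (√(2 * Real.pi * v))⁻¹ + -(x - m) ^ 2 / (2 * v) := by
  have : (0 : ℝ) < v := by positivity
  rw [gaussianPDFReal, Real.log_mul (by positivity) (Real.exp_pos _).ne', Real.log_exp]

end Gaussian

/-! ### The score and the Fisher information matrix. -/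

section Score

open scoped Classical

variable {ι : Type*} [Fintype ι] {G : SimpleGraph ι} {N : ℕ}

/-- The oriented incidence coefficient of a node and an oriented edge. -/
def incidence (d : G.Dart) (i : ι) : ℝ :=
  (if d.snd = i then 1 else 0) - (if d.fst = i then 1 else 0)

lemma hasDerivAt_update_apply {ι : Type*} [Fintype ι] (θ : ι → ℝ) (i k : ι) :
    HasDerivAt (fun t => Function.update θ i t k) (if k = i then 1 else 0) (θ i) := by
  have := (hasDerivAt_pi.1 (_root_.hasDerivAt_update θ i (θ i))) k
  simpa [Pi.single_apply] using this

lemma score_eq {v : ℝ≥0} (hv : v ≠ 0) (prior : ι → Option PriorDensity)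
    (τ : ObsIndex G N → ℝ) (θ : ι → ℝ) (hθ : ∀ k, 0 < priorFactor (prior k) (θ k)) (i : ι) :
    score G N v prior τ θ i = priorScore (prior i) (θ i) +
      ∑ e : ObsIndex G N, (2 * incidence e.1 i / v) * (τ e - obsMean θ e) := by
  have hv' : (0 : ℝ) < v := by positivity
  -- The logarithm of the product splits only where all factors are nonzero; a prior density may
  -- vanish away from θ i, so the identity is local.
  have hev : (fun t => Real.log (jointDensity G N v prior τ (Function.update θ i t))) =ᶠ[𝓝 (θ i)]
      fun t => (∑ k, Real.log (priorFactor (prior k) (Function.update θ i t k))) +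
        ∑ e : ObsIndex G N, (Real.log (√(2 * Real.pi * v))⁻¹ +
          -(τ e - obsMean (Function.update θ i t) e) ^ 2 / (2 * v)) := by
    have h1 : ∀ᶠ t in 𝓝 (θ i), 0 < priorFactor (prior i) t :=
      (differentiable_priorFactor (prior i)).continuous.continuousAt.eventually
        (lt_mem_nhds (hθ i))
    filter_upwards [h1] with t ht
    have h2 : ∀ k, 0 < priorFactor (prior k) (Function.update θ i t k) := fun k => by
      by_cases hk : k = i
      · subst hk; simpa using ht
      · simpa [Function.update_of_ne hk] using hθ k
    rw [jointDensity, Real.log_mul (Finset.prod_ne_zero_iff.2 fun k _ => (h2 k).ne')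
      (Finset.prod_ne_zero_iff.2 fun e _ => (gaussianPDFReal_pos _ _ _ hv).ne'),
      Real.log_prod fun k _ => (h2 k).ne',
      Real.log_prod fun e _ => (gaussianPDFReal_pos _ _ _ hv).ne']
    simp_rw [log_gaussianPDFReal hv]
  rw [score, hev.deriv_eq]
  have hprior : HasDerivAt (fun t => ∑ k, Real.log (priorFactor (prior k)
      (Function.update θ i t k))) (priorScore (prior i) (θ i)) (θ i) := by
    have : ∀ k ∈ Finset.univ, HasDerivAt (fun t => Real.log (priorFactor (prior k)
        (Function.update θ i t k))) (if k = i then priorScore (prior i) (θ i) else 0) (θ i) := by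
      intro k _
      by_cases hk : k = i
      · subst hk
        simp only [Function.update_self, if_true]
        exact ((differentiable_priorFactor (prior k) (θ k)).log (hθ k).ne').hasDerivAt
      · simp only [Function.update_of_ne hk, hk, if_false]
        exact hasDerivAt_const _ _
    simpa using HasDerivAt.fun_sum this
  have hobs : HasDerivAt (fun t => ∑ e : ObsIndex G N, (Real.log (√(2 * Real.pi * v))⁻¹ +
      -(τ e - obsMean (Function.update θ i t) e) ^ 2 / (2 * v)))
      (∑ e : ObsIndex G N, (2 * incidence e.1 i / v) * (τ e - obsMean θ e)) (θ i) := by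
    refine HasDerivAt.fun_sum fun e _ => ?_
    have hm : HasDerivAt (fun t => obsMean (Function.update θ i t) e) (2 * incidence e.1 i)
        (θ i) :=
      ((hasDerivAt_update_apply θ i e.1.snd).sub (hasDerivAt_update_apply θ i e.1.fst)).const_mul 2
    have h3 := (((((hm.const_sub (τ e)).pow 2).neg).div_const (2 * (v : ℝ))).const_add
      (Real.log (√(2 * Real.pi * v))⁻¹))
    convert h3 using 1
    · rfl
    · simp only [Function.update_eq_self]
      push_cast
      field_simp
  exact (hprior.add hobs).deriv

lemma offsetLaw_eq (prior : ι → Option PriorDensity) (θ₀ : ι → ℝ) :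
    offsetLaw prior θ₀ = Measure.pi fun k => singleOffsetLaw (prior k) (θ₀ k) := rfl

/-- The Fisher information matrix is a weighted graph Laplacian plus the diagonal matrix of the
amounts of a priori information. -/
lemma fim_apply {v : ℝ≥0} (hv : v ≠ 0) (prior : ι → Option PriorDensity) (θ₀ : ι → ℝ)
    (hprior : ∀ k, ∀ f ∈ prior k, f.information ≠ 0) (i j : ι) :
    fim G N v prior θ₀ i j = (if i = j then priorInfo (prior i) else 0) +
      (4 * N / v) * ∑ d : G.Dart, incidence d i * incidence d j := by
  have hv' : (v : ℝ) ≠ 0 := by positivity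
  have hpos : ∀ᵐ θ ∂offsetLaw prior θ₀, ∀ k, 0 < priorFactor (prior k) (θ k) := by
    rw [offsetLaw_eq, eventually_all]
    exact fun k => (Measure.tendsto_eval_ae_ae (μ := fun k => singleOffsetLaw (prior k) (θ₀ k))
      (i := k)).eventually (ae_priorFactor_pos (prior k) (θ₀ k))
  -- Given θ the prior scores are constants. Each of the N observations on a dart contributes (2/v)²
  -- · v = 4/v times the incidence coefficients.
  have hin : ∀ᵐ θ ∂offsetLaw prior θ₀,
      ∫ τ, score G N v prior τ θ i * score G N v prior τ θ j ∂obsLaw G N v θ =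
        priorScore (prior i) (θ i) * priorScore (prior j) (θ j) +
          (4 * N / v) * ∑ d : G.Dart, incidence d i * incidence d j := by
    filter_upwards [hpos] with θ hθ
    simp_rw [score_eq hv prior _ θ hθ]
    rw [obsLaw, integral_pi_affine_mul_affine (μ := fun e => gaussianReal (obsMean θ e) v)
      (Z := fun e x => x - obsMean θ e) (fun e => memLp_sub_gaussianReal _ _)
      (fun e => integral_sub_gaussianReal _ _)]
    simp_rw [integral_sub_sq_gaussianReal]
    congr 1
    rw [Fintype.sum_prod_type, Finset.mul_sum]
    refine Finset.sum_congr rfl fun d _ => ?_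
    simp only [Finset.sum_const, Finset.card_univ, Fintype.card_fin, nsmul_eq_mul]
    field_simp
    ring
  have hL : ∀ k, MemLp (priorScore (prior k)) 2 (singleOffsetLaw (prior k) (θ₀ k)) := fun k =>
    memLp_priorScore _ _ (hprior k)
  rw [fim, Matrix.of_apply, integral_congr_ae hin, offsetLaw_eq,
    integral_add (integrable_pi_eval_mul_eval hL i j) (integrable_const _),
    integral_pi_eval_mul_eval hL (fun k => integral_priorScore _ _ (hprior k)),
    integral_priorScore_sq]
  simp

end Score

/-! ### Lower and upper bounds on the diagonal of the inverse. -/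

section Bounds

open scoped Classical Matrix

variable {ι : Type*} [Fintype ι] {G : SimpleGraph ι} {N : ℕ}

lemma le_aseb {J : Matrix ι ι ℝ} (hsymm : J.IsSymm) (hnonneg : ∀ x : ι → ℝ, 0 ≤ x ⬝ᵥ J *ᵥ x)
    (i : ι) {M : ℝ} (hM : 0 < M) (hJM : J i i ≤ M) : ENNReal.ofReal (1 / M) ≤ aseb J i := by
  rw [aseb]
  split_ifs with hdet
  · refine ENNReal.ofReal_le_ofReal ?_
    set e : ι → ℝ := Pi.single i 1 with he
    set x : ι → ℝ := J⁻¹ *ᵥ e with hx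
    have hJx : J *ᵥ x = e := by
      rw [hx, Matrix.mulVec_mulVec, Matrix.mul_nonsing_inv _ hdet, Matrix.one_mulVec]
    have hxi : x i = J⁻¹ i i := by simp [hx, he]
    have hJe : e ⬝ᵥ J *ᵥ e = J i i := by simp [he]
    have hxJe : x ⬝ᵥ J *ᵥ e = 1 := by
      rw [Matrix.dotProduct_mulVec, ← Matrix.mulVec_transpose, hsymm.eq, hJx]
      simp [he]
    -- With x = J⁻¹e, expanding the form at x - e/M gives x_i - 2/M + J_ii/M² ≥ 0, whence x_i ≥ 1/M.
    have h := hnonneg (x - (1 / M) • e)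
    rw [Matrix.mulVec_sub, Matrix.mulVec_smul, hJx] at h
    simp only [sub_dotProduct, dotProduct_sub, smul_dotProduct, dotProduct_smul, hxJe, hJe,
      smul_eq_mul] at h
    have h1 : x ⬝ᵥ e = x i := by simp [he]
    have h2 : e ⬝ᵥ e = 1 := by simp [he]
    rw [h1, h2, hxi] at h
    have h3 : 1 / M * (1 / M * J i i) ≤ 1 / M * (1 / M * M) := by gcongr
    have h4 : 1 / M * (1 / M * M) = 1 / M := by field_simp
    linarith
  · exact le_top

lemma fim_isSymm {v : ℝ≥0} (hv : v ≠ 0) (prior : ι → Option PriorDensity) (θ₀ : ι → ℝ)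
    (hprior : ∀ k, ∀ f ∈ prior k, f.information ≠ 0) : (fim G N v prior θ₀).IsSymm := by
  ext i j
  rw [Matrix.transpose_apply, fim_apply hv prior θ₀ hprior, fim_apply hv prior θ₀ hprior]
  congr 1
  · by_cases h : i = j
    · subst h; rfl
    · rw [if_neg h, if_neg (Ne.symm h)]
  · simp_rw [mul_comm]

lemma sum_incidence_mul (d : G.Dart) (x : ι → ℝ) :
    ∑ i, incidence d i * x i = x d.snd - x d.fst := by
  simp [incidence, sub_mul, Finset.sum_sub_distrib]

lemma dotProduct_fim_mulVec {v : ℝ≥0} (hv : v ≠ 0) (prior : ι → Option PriorDensity)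
    (θ₀ : ι → ℝ) (hprior : ∀ k, ∀ f ∈ prior k, f.information ≠ 0) (x : ι → ℝ) :
    x ⬝ᵥ fim G N v prior θ₀ *ᵥ x = ∑ i, priorInfo (prior i) * x i ^ 2 +
      (4 * N / v) * ∑ d : G.Dart, (x d.snd - x d.fst) ^ 2 := by
  have h : ∀ i, (fim G N v prior θ₀ *ᵥ x) i = priorInfo (prior i) * x i +
      (4 * N / v) * ∑ d : G.Dart, incidence d i * (x d.snd - x d.fst) := fun i => by
    simp_rw [Matrix.mulVec, dotProduct, fim_apply hv prior θ₀ hprior, add_mul,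
      Finset.sum_add_distrib, ← sum_incidence_mul]
    congr 1
    · simp
    · simp_rw [mul_assoc, ← Finset.mul_sum, Finset.sum_mul, Finset.mul_sum]
      rw [Finset.sum_comm]
      simp_rw [mul_assoc]
  simp_rw [dotProduct, h, mul_add, Finset.sum_add_distrib]
  congr 1
  · exact Finset.sum_congr rfl fun i _ => by ring
  · simp_rw [Finset.mul_sum]
    rw [Finset.sum_comm]
    refine Finset.sum_congr rfl fun d _ => ?_
    calc ∑ i, x i * (4 * N / v * (incidence d i * (x d.snd - x d.fst)))
        = 4 * N / v * ((∑ i, incidence d i * x i) * (x d.snd - x d.fst)) := by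
          rw [Finset.sum_mul, Finset.mul_sum]
          exact Finset.sum_congr rfl fun i _ => by ring
      _ = _ := by rw [sum_incidence_mul]; ring

lemma priorInfo_nonneg (o : Option PriorDensity) : 0 ≤ priorInfo o := by
  cases o with
  | none => exact le_rfl
  | some f => exact integral_nonneg fun x => sq_nonneg _

/-- Each neighbour of i accounts for two darts, one per direction; this doubles 4N/v to 8N/v. -/
lemma fim_diag_le {v : ℝ≥0} (hv : v ≠ 0) (prior : ι → Option PriorDensity)
    (θ₀ : ι → ℝ) (hprior : ∀ k, ∀ f ∈ prior k, f.information ≠ 0) (i : ι) :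
    fim G N v prior θ₀ i i ≤ priorInfo (prior i) +
      (8 * N / v) * ∑ j, if G.Adj i j then 1 else 0 := by
  rw [fim_apply hv prior θ₀ hprior, if_pos rfl]
  have h1 : ∀ d : G.Dart, incidence d i * incidence d i =
      (if d.snd = i then 1 else 0) + (if d.fst = i then 1 else 0) := fun d => by
    have := d.adj.ne
    rw [incidence]
    split_ifs with h h' <;> simp_all
  have hfst : ∑ d : G.Dart, (if d.fst = i then (1 : ℝ) else 0) =
      ∑ j, if G.Adj i j then 1 else 0 := by
    rw [Finset.sum_boole, Finset.sum_boole]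
    norm_cast
    rw [G.dart_fst_fiber_card_eq_degree i, ← G.card_neighborFinset_eq_degree,
      G.neighborFinset_eq_filter]
  have hsnd : ∑ d : G.Dart, (if d.snd = i then (1 : ℝ) else 0) =
      ∑ d : G.Dart, (if d.fst = i then (1 : ℝ) else 0) :=
    Equiv.sum_comp (Function.Involutive.toPerm _ SimpleGraph.Dart.symm_involutive)
      fun d : G.Dart => if d.fst = i then (1 : ℝ) else 0
  simp_rw [h1, Finset.sum_add_distrib]
  rw [hsnd, hfst]
  apply le_of_eq
  ring

lemma walk_sum_darts {ι : Type*} {G : SimpleGraph ι} (x : ι → ℝ) {i a : ι} (w : G.Walk i a) :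
    (w.darts.map fun d => x d.snd - x d.fst).sum = x a - x i := by
  induction w with
  | nil => simp
  | cons h p ih => simp [ih]

/-- Cauchy–Schwarz along the telescoping sum. The darts of a path are distinct, so their energy is
part of the total energy. -/
lemma sq_sub_le_of_isPath (x : ι → ℝ) {i a : ι} (w : G.Walk i a) (hw : w.IsPath) :
    (x a - x i) ^ 2 ≤ w.length * ∑ d : G.Dart, (x d.snd - x d.fst) ^ 2 := by
  have hnd : w.darts.Nodup := List.Nodup.of_map _ hw.isTrail.edges_nodup
  rw [← walk_sum_darts x w, ← List.sum_toFinset _ hnd]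
  refine sq_sum_le_card_mul_sum_sq.trans ?_
  rw [List.toFinset_card_of_nodup hnd, SimpleGraph.Walk.length_darts]
  gcongr
  exact Finset.subset_univ _

/-- Resistances in series: 1/ξ from the ground to the agent with a prior, ℓ/κ along the path. The
cross term satisfies 2|xa·D| ≤ p + q because (xa·D)² ≤ pq. -/
lemma sq_le_resistance_mul_energy {xa D S ξ κ ℓ : ℝ} (hξ : 0 < ξ) (hκ : 0 < κ) (hℓ : 0 ≤ ℓ)
    (hS : 0 ≤ S) (hD : D ^ 2 ≤ ℓ * S) :
    (xa + D) ^ 2 ≤ (1 / ξ + ℓ / κ) * (ξ * xa ^ 2 + κ * S) := by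
  set p := ξ * ℓ / κ * xa ^ 2 with hp
  set q := κ * S / ξ with hq
  have hpq : (2 * (xa * D)) ^ 2 ≤ (p + q) ^ 2 := by
    have h1 : p * q = xa ^ 2 * (ℓ * S) := by rw [hp, hq]; field_simp
    have h2 : xa ^ 2 * D ^ 2 ≤ xa ^ 2 * (ℓ * S) := by gcongr
    nlinarith [sq_nonneg (p - q)]
  have h3 := abs_le_of_sq_le_sq' hpq (by positivity)
  have h4 : (1 / ξ + ℓ / κ) * (ξ * xa ^ 2 + κ * S) = xa ^ 2 + p + q + ℓ * S := by
    rw [hp, hq]; field_simp; ring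
  rw [h4]
  nlinarith [h3.2]

/-- The error bound of an agent is at most the effective resistance of a path that leads to an
agent with a priori information. -/
lemma aseb_fim_le {v : ℝ≥0} (hv : v ≠ 0) (hN : 0 < N) (hG : G.Connected)
    (prior : ι → Option PriorDensity) (θ₀ : ι → ℝ)
    (hprior : ∀ k, ∀ f ∈ prior k, f.information ≠ 0) {ξ : ℝ} (hξ : 0 < ξ) {i a : ι}
    (ha : ξ ≤ priorInfo (prior a)) :
    aseb (fim G N v prior θ₀) i ≤ ENNReal.ofReal (1 / ξ + G.dist i a / (4 * N / v)) := by
  have hκ : (0 : ℝ) < 4 * N / v := by positivity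
  set Q : (ι → ℝ) → ℝ := fun x => x ⬝ᵥ fim G N v prior θ₀ *ᵥ x with hQ
  have key : ∀ (x : ι → ℝ) (j : ι), x j ^ 2 ≤ (1 / ξ + G.dist j a / (4 * N / v)) * Q x := by
    intro x j
    obtain ⟨w, hw, hlen⟩ := hG.exists_path_of_dist j a
    have hD := sq_sub_le_of_isPath x w hw
    rw [hlen] at hD
    have h0 : (0 : ℝ) ≤ ∑ d : G.Dart, (x d.snd - x d.fst) ^ 2 :=
      Finset.sum_nonneg fun d _ => sq_nonneg _
    have h1 := sq_le_resistance_mul_energy (xa := x a) (D := x j - x a) hξ hκ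
      (Nat.cast_nonneg (G.dist j a)) h0 (by rw [← neg_sub, neg_sq]; exact hD)
    rw [add_sub_cancel] at h1
    refine h1.trans ?_
    rw [hQ]
    simp only [dotProduct_fim_mulVec hv prior θ₀ hprior]
    gcongr
    calc ξ * x a ^ 2 ≤ priorInfo (prior a) * x a ^ 2 := by gcongr
      _ ≤ _ := Finset.single_le_sum (f := fun i => priorInfo (prior i) * x i ^ 2)
        (fun i _ => mul_nonneg (priorInfo_nonneg _) (sq_nonneg _)) (Finset.mem_univ a)
  -- By `key`, a kernel vector has zero energy and thus vanishes at every vertex.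
  have hdet : IsUnit (fim G N v prior θ₀).det := by
    rw [isUnit_iff_ne_zero]
    intro h
    obtain ⟨x, hx, hJx⟩ := Matrix.exists_mulVec_eq_zero_iff.2 h
    apply hx
    ext j
    have := key x j
    simp only [hQ, hJx, dotProduct_zero, mul_zero] at this
    exact pow_eq_zero_iff two_ne_zero |>.1 (le_antisymm this (sq_nonneg _))
  rw [aseb, if_pos hdet]
  refine ENNReal.ofReal_le_ofReal ?_
  set e : ι → ℝ := Pi.single i 1 with he
  set x : ι → ℝ := (fim G N v prior θ₀)⁻¹ *ᵥ e with hx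
  have hJx : fim G N v prior θ₀ *ᵥ x = e := by
    rw [hx, Matrix.mulVec_mulVec, Matrix.mul_nonsing_inv _ hdet, Matrix.one_mulVec]
  have hxi : x i = (fim G N v prior θ₀)⁻¹ i i := by simp [hx, he]
  have hQx : Q x = x i := by simp [hQ, hJx, he]
  -- For x = J⁻¹e_i the energy equals x_i, so the inequality reads x_i² ≤ C x_i.
  have h := key x i
  rw [hQx] at h
  rw [← hxi]
  have hC : (0 : ℝ) ≤ 1 / ξ + G.dist i a / (4 * N / v) := by positivity
  by_contra hlt
  push Not at hlt
  nlinarith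

end Bounds

/-! ### Mean distance to a random set of vertices in a connected graph. -/

section Depth

open scoped Classical

variable {n : ℕ}

/-- The distance of a vertex from a set of vertices, counted through the balls around the vertex
that the set misses. -/
def depth (G : SimpleGraph (Fin n)) (A : Finset (Fin n)) (i : Fin n) : ℕ :=
  ((Finset.range n).filter fun r => ∀ a ∈ A, r < G.dist i a).card

/-- Every radius below the distance to the nearest point of A is counted by `depth`. The cut-off at
n loses nothing, since distances in a connected graph are below n. -/
lemma exists_dist_le_depth {G : SimpleGraph (Fin n)} (hG : G.Connected) {A : Finset (Fin n)}
    (hA : A.Nonempty) (i : Fin n) : ∃ a ∈ A, G.dist i a ≤ depth G A i := by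
  obtain ⟨a, ha, hmin⟩ := A.exists_min_image (fun a => G.dist i a) hA
  refine ⟨a, ha, ?_⟩
  obtain ⟨w, hw, hlen⟩ := hG.exists_path_of_dist i a
  have hlt : G.dist i a < n := by
    have := hw.length_lt
    rwa [hlen, Fintype.card_fin] at this
  calc G.dist i a = (Finset.range (G.dist i a)).card := (Finset.card_range _).symm
    _ ≤ _ := by
      refine Finset.card_le_card fun r hr => ?_
      rw [Finset.mem_range] at hr
      rw [Finset.mem_filter, Finset.mem_range]
      exact ⟨hr.trans hlt, fun b hb => hr.trans_le (hmin b hb)⟩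

/-- Either a shortest path leaves the ball, and its first r + 1 vertices are distinct and inside, or
the ball is everything. -/
lemma lt_card_ball {G : SimpleGraph (Fin n)} (hG : G.Connected) (i : Fin n) {r : ℕ} (hr : r < n) :
    r < (Finset.univ.filter fun u => G.dist i u ≤ r).card := by
  by_cases h : ∃ u, r < G.dist i u
  · obtain ⟨u, hu⟩ := h
    obtain ⟨w, hw, hlen⟩ := hG.exists_path_of_dist i u
    calc r < (Finset.range (r + 1)).card := by simp
      _ = ((Finset.range (r + 1)).image w.getVert).card := by
        refine (Finset.card_image_of_injOn fun j hj k hk hjk => ?_).symm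
        simp only [Finset.coe_range, Set.mem_Iio] at hj hk
        exact hw.getVert_injOn (by simp only [Set.mem_ofPred_eq]; omega)
          (by simp only [Set.mem_ofPred_eq]; omega) hjk
      _ ≤ _ := by
        refine Finset.card_le_card fun y hy => ?_
        obtain ⟨j, hj, rfl⟩ := Finset.mem_image.1 hy
        rw [Finset.mem_range] at hj
        rw [Finset.mem_filter]
        refine ⟨Finset.mem_univ _, (SimpleGraph.dist_le (w.take j)).trans ?_⟩
        rw [SimpleGraph.Walk.take_length]
        omega
  · push Not at h
    rw [Finset.filter_true_of_mem fun u _ => h u]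
    simpa using hr

lemma sum_range_choose_eq (n k : ℕ) : ∑ r ∈ Finset.range n, (n - (r + 1)).choose k =
    n.choose (k + 1) := by
  induction n with
  | zero => simp
  | succ n ih =>
    rw [Finset.sum_range_succ', Nat.choose_succ_succ, ← ih, add_comm]
    simp

/-- The depth with respect to a random `k`-subset of a connected graph is bounded on average. -/
lemma sum_depth_le {G : SimpleGraph (Fin n)} (hG : G.Connected) (k : ℕ) :
    ∑ A ∈ Finset.powersetCard k Finset.univ, ∑ i, depth G A i ≤ n * n.choose (k + 1) := by
  rw [Finset.sum_comm]
  have h : ∀ i, ∑ A ∈ Finset.powersetCard k Finset.univ, depth G A i ≤ n.choose (k + 1) := by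
    intro i
    simp_rw [depth, Finset.card_filter]
    -- Count by radius: the k-sets that miss the ball of radius r lie in its complement, which has
    -- at most n - (r + 1) vertices. The hockey-stick identity sums these counts.
    rw [Finset.sum_comm, ← sum_range_choose_eq]
    refine Finset.sum_le_sum fun r hr => ?_
    rw [Finset.mem_range] at hr
    rw [← Finset.card_filter]
    set B := Finset.univ.filter fun u => G.dist i u ≤ r
    calc _ ≤ (Finset.powersetCard k Bᶜ).card := by
          refine Finset.card_le_card fun A hA => ?_
          rw [Finset.mem_filter, Finset.mem_powersetCard] at hA
          rw [Finset.mem_powersetCard]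
          refine ⟨fun a ha => ?_, hA.1.2⟩
          simpa [B] using hA.2 a ha
      _ = (n - B.card).choose k := by
          rw [Finset.card_powersetCard, Finset.card_compl, Fintype.card_fin]
      _ ≤ _ := Nat.choose_le_choose _ (Nat.sub_le_sub_left (lt_card_ball hG i hr) n)
  calc _ ≤ ∑ _i : Fin n, n.choose (k + 1) := Finset.sum_le_sum fun i _ => h i
    _ = _ := by simp

lemma choose_succ_mul_le (n k : ℕ) : n.choose (k + 1) * k ≤ n * n.choose k := by
  have h := Nat.choose_succ_right_eq n k
  calc n.choose (k + 1) * k ≤ n.choose (k + 1) * (k + 1) := by gcongr; omega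
    _ = n.choose k * (n - k) := h
    _ ≤ n.choose k * n := by gcongr; omega
    _ = _ := mul_comm _ _

lemma dist_iso {V W : Type*} {G : SimpleGraph V} {H : SimpleGraph W} (e : G ≃g H)
    (hG : G.Connected) (u w : V) : H.dist (e u) (e w) = G.dist u w := by
  apply le_antisymm
  · obtain ⟨p, hp⟩ := hG.exists_walk_length_eq_dist u w
    rw [← hp, ← SimpleGraph.Walk.length_map e.toHom p]
    exact SimpleGraph.dist_le (p.map e.toHom)
  · obtain ⟨p, hp⟩ := (e.connected_iff.1 hG).exists_walk_length_eq_dist (e u) (e w)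
    rw [← hp, ← SimpleGraph.Walk.length_map e.symm.toHom p]
    refine (SimpleGraph.dist_le (p.map e.symm.toHom)).trans' (le_of_eq ?_)
    simp

lemma depth_iso {G H : SimpleGraph (Fin n)} (e : G ≃g H) (hG : G.Connected)
    (A : Finset (Fin n)) (i : Fin n) :
    depth H (A.map e.toEquiv.toEmbedding) (e i) = depth G A i := by
  simp only [depth, Finset.forall_mem_map]
  congr 1
  ext r
  simp [dist_iso e hG]

end Depth

/-! ### Exchangeability and the upper bound. -/

section Symmetrization

open scoped Classical

variable {n : ℕ}

lemma commGraph_adj {ι : Type*} (Rmax : ℝ) (p : ι → Plane) (i j : ι) :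
    (commGraph Rmax p).Adj i j ↔ i ≠ j ∧ dist (p i) (p j) ≤ Rmax := by
  simp [commGraph, dist_comm (p j) (p i)]

lemma commGraph_comp (Rmax : ℝ) (p : Fin n → Plane) (σ : Equiv.Perm (Fin n)) :
    commGraph Rmax (p ∘ σ) = (commGraph Rmax p).comap σ := by
  ext i j
  simp [commGraph_adj]

/-- There are finitely many graphs on `Fin n`, and each is attained on a measurable set of
positions, so any function of the graph is measurable, error bounds included. -/
lemma measurable_comp_commGraph {β : Type*} [MeasurableSpace β] (Rmax : ℝ)
    (h : SimpleGraph (Fin n) → β) : Measurable fun p : Fin n → Plane => h (commGraph Rmax p) := by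
  let _ : MeasurableSpace (SimpleGraph (Fin n)) := ⊤
  have hg : Measurable fun p : Fin n → Plane => commGraph Rmax p := by
    refine measurable_to_countable' fun G => ?_
    have : (fun p : Fin n → Plane => commGraph Rmax p) ⁻¹' {G} =
        ⋂ i, ⋂ j, {p | (i ≠ j ∧ dist (p i) (p j) ≤ Rmax) ↔ G.Adj i j} := by
      ext p
      simp only [Set.mem_preimage, Set.mem_singleton_iff, Set.mem_iInter, Set.mem_ofPred_eq,
        ← commGraph_adj]
      exact ⟨fun h i j => by rw [h], fun h => by ext i j; exact h i j⟩
    rw [this]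
    refine MeasurableSet.iInter fun i => MeasurableSet.iInter fun j => ?_
    have hd : MeasurableSet {p : Fin n → Plane | dist (p i) (p j) ≤ Rmax} :=
      measurableSet_le (by fun_prop) measurable_const
    exact ((MeasurableSet.const _).inter hd).iff (MeasurableSet.const _)
  exact (measurable_from_top (f := h)).comp hg

lemma measurableSet_connected (Rmax : ℝ) :
    MeasurableSet {p : Fin n → Plane | (commGraph Rmax p).Connected} :=
  measurableSet_setOfPred.2 (measurable_comp_commGraph Rmax fun G => G.Connected)

lemma measurePreserving_comp_perm (ν : Measure Plane) [IsProbabilityMeasure ν]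
    (σ : Equiv.Perm (Fin n)) :
    MeasurePreserving (fun p : Fin n → Plane => p ∘ σ) (Measure.pi fun _ => ν)
      (Measure.pi fun _ => ν) :=
  measurePreserving_arrowCongr' (fun _ => ν) (fun _ => ν) σ.symm (MeasurableEquiv.refl Plane)
    fun _ => MeasurePreserving.id ν

lemma exists_perm_map_eq {A B : Finset (Fin n)} (h : A.card = B.card) :
    ∃ σ : Equiv.Perm (Fin n), A.map σ.toEmbedding = B := by
  let e : {x // x ∈ A} ≃ {x // x ∈ B} := Finset.equivOfCardEq h
  refine ⟨e.extendSubtype, Finset.eq_of_subset_of_card_le (fun b hb => ?_) (by simp [h])⟩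
  obtain ⟨a, ha, rfl⟩ := Finset.mem_map.1 hb
  exact e.extendSubtype_mem a ha

/-- The sum of the depths of all vertices of a connected graph. -/
def totalDepth (G : SimpleGraph (Fin n)) (A : Finset (Fin n)) : ℝ≥0∞ :=
  if G.Connected then ((∑ i, depth G A i : ℕ) : ℝ≥0∞) else 0

lemma totalDepth_comap (G : SimpleGraph (Fin n)) (σ : Equiv.Perm (Fin n)) (A : Finset (Fin n)) :
    totalDepth (G.comap σ) A = totalDepth G (A.map σ.toEmbedding) := by
  have hiff := (SimpleGraph.Iso.comap σ G).connected_iff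
  rw [totalDepth, totalDepth]
  by_cases hG : G.Connected
  · have hG' := hiff.2 hG
    have hsum : ∑ i, depth (G.comap σ) A i = ∑ i, depth G (A.map σ.toEmbedding) i := by
      rw [← Equiv.sum_comp σ fun i => depth G (A.map σ.toEmbedding) i]
      exact Finset.sum_congr rfl fun i _ => (depth_iso (SimpleGraph.Iso.comap σ G) hG' A i).symm
    rw [if_pos hG, if_pos hG', hsum]
  · rw [if_neg hG, if_neg (hiff.not.2 hG)]

/-- A permutation of the agents that carries A to B preserves the law of the positions and relabels
the graph. -/
lemma lintegral_totalDepth_congr (ν : Measure Plane) [IsProbabilityMeasure ν] (Rmax : ℝ)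
    {A B : Finset (Fin n)} (h : A.card = B.card) :
    ∫⁻ p, totalDepth (commGraph Rmax p) A ∂(Measure.pi fun _ : Fin n => ν) =
      ∫⁻ p, totalDepth (commGraph Rmax p) B ∂(Measure.pi fun _ : Fin n => ν) := by
  obtain ⟨σ, rfl⟩ := exists_perm_map_eq h
  rw [← (measurePreserving_comp_perm ν σ).lintegral_comp
    (measurable_comp_commGraph Rmax fun G => totalDepth G A)]
  simp_rw [commGraph_comp, totalDepth_comap]

lemma sum_totalDepth_le (G : SimpleGraph (Fin n)) (k : ℕ) :
    ∑ A ∈ Finset.powersetCard k Finset.univ, totalDepth G A ≤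
      if G.Connected then ((n * n.choose (k + 1) : ℕ) : ℝ≥0∞) else 0 := by
  simp only [totalDepth]
  split_ifs with hG
  · exact_mod_cast sum_depth_le hG k
  · simp

/-- Since the law of the positions is exchangeable, the agents with a priori information may be
replaced by a random set of agents of the same size. -/
lemma card_mul_lintegral_totalDepth_le (ν : Measure Plane) [IsProbabilityMeasure ν] (Rmax : ℝ)
    (A : Finset (Fin n)) :
    A.card * ∫⁻ p, totalDepth (commGraph Rmax p) A ∂(Measure.pi fun _ : Fin n => ν) ≤
      n * n * (Measure.pi fun _ : Fin n => ν) {p | (commGraph Rmax p).Connected} := by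
  set μ := Measure.pi fun _ : Fin n => ν
  set k := A.card with hk
  have hkn : k ≤ n := by simpa using A.card_le_univ
  -- All k-subsets have the same integral, so C(n,k) copies of it make up the sum over all of them,
  -- which is bounded pointwise.
  have hsum : (n.choose k : ℝ≥0∞) * ∫⁻ p, totalDepth (commGraph Rmax p) A ∂μ ≤
      ((n * n.choose (k + 1) : ℕ) : ℝ≥0∞) * μ {p | (commGraph Rmax p).Connected} := by
    calc (n.choose k : ℝ≥0∞) * ∫⁻ p, totalDepth (commGraph Rmax p) A ∂μ
        = ∑ B ∈ Finset.powersetCard k (Finset.univ : Finset (Fin n)),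
            ∫⁻ p, totalDepth (commGraph Rmax p) B ∂μ := by
          rw [Finset.sum_congr rfl fun B hB => lintegral_totalDepth_congr ν Rmax
            (A := B) (B := A) (Finset.mem_powersetCard.1 hB).2, Finset.sum_const,
            Finset.card_powersetCard, nsmul_eq_mul]
          simp [μ, hk]
      _ = ∫⁻ p, ∑ B ∈ Finset.powersetCard k (Finset.univ : Finset (Fin n)),
            totalDepth (commGraph Rmax p) B ∂μ :=
          (lintegral_finsetSum _ fun B _ =>
            measurable_comp_commGraph Rmax fun G => totalDepth G B).symm
      _ ≤ ∫⁻ p, {p | (commGraph Rmax p).Connected}.indicator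
            (fun _ => ((n * n.choose (k + 1) : ℕ) : ℝ≥0∞)) p ∂μ :=
          lintegral_mono fun p => by
            refine (sum_totalDepth_le (commGraph Rmax p) k).trans (le_of_eq ?_)
            simp [Set.indicator_apply]
      _ = _ := by rw [lintegral_indicator_const (measurableSet_connected Rmax)]
  have hc0 : (n.choose k : ℝ≥0∞) ≠ 0 := by
    exact_mod_cast (Nat.choose_pos hkn).ne'
  refine (ENNReal.mul_le_mul_iff_right hc0 (ENNReal.natCast_ne_top _)).1 ?_
  calc (n.choose k : ℝ≥0∞) * (k * ∫⁻ p, totalDepth (commGraph Rmax p) A ∂μ)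
      = k * (n.choose k * ∫⁻ p, totalDepth (commGraph Rmax p) A ∂μ) := by ring
    _ ≤ k * (((n * n.choose (k + 1) : ℕ) : ℝ≥0∞) * μ {p | (commGraph Rmax p).Connected}) := by
        gcongr
    _ = ((n * (n.choose (k + 1) * k) : ℕ) : ℝ≥0∞) * μ {p | (commGraph Rmax p).Connected} := by
        push_cast; ring
    _ ≤ ((n * (n * n.choose k) : ℕ) : ℝ≥0∞) * μ {p | (commGraph Rmax p).Connected} := by
        refine mul_le_mul_left (Nat.cast_le.2 (Nat.mul_le_mul_left n ?_)) _
        exact choose_succ_mul_le n k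
    _ = _ := by push_cast; ring

/-- The number of agents with a priori information. -/
def numPrior (prior : Fin n → Option PriorDensity) : ℕ :=
  (Finset.univ.filter fun k => (prior k).isSome).card

lemma sum_aseb_le {G : SimpleGraph (Fin n)} (hG : G.Connected) {N : ℕ} (hN : 0 < N) {v : ℝ≥0}
    (hv : v ≠ 0) (prior : Fin n → Option PriorDensity) (θ₀ : Fin n → ℝ) {ξ : ℝ} (hξ : 0 < ξ)
    (hprior : ∀ k, ∀ f ∈ prior k, ξ ≤ f.information) (hpos : 0 < numPrior prior) :
    ∑ i, aseb (fim G N v prior θ₀) i ≤ n * ENNReal.ofReal (1 / ξ) +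
      ENNReal.ofReal (1 / (4 * N / v)) *
        totalDepth G (Finset.univ.filter fun k => (prior k).isSome) := by
  have hκ : (0 : ℝ) < 4 * N / v := by positivity
  set A := Finset.univ.filter fun k => (prior k).isSome
  have h : ∀ i, aseb (fim G N v prior θ₀) i ≤
      ENNReal.ofReal (1 / ξ) + ENNReal.ofReal (1 / (4 * N / v)) * depth G A i := by
    intro i
    obtain ⟨a, ha, hdist⟩ := exists_dist_le_depth hG (Finset.card_pos.1 hpos) i
    obtain ⟨f, hf⟩ := Option.isSome_iff_exists.1 (Finset.mem_filter.1 ha).2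
    refine (aseb_fim_le hv hN hG prior θ₀ (fun k f hf => (hξ.trans_le (hprior k f hf)).ne') hξ
      (a := a) (by rw [hf]; exact hprior a f hf)).trans ?_
    rw [← ENNReal.ofReal_natCast (depth G A i), ← ENNReal.ofReal_mul (by positivity),
      ← ENNReal.ofReal_add (by positivity) (by positivity)]
    refine ENNReal.ofReal_le_ofReal ?_
    rw [one_div_mul_eq_div]
    gcongr
  calc _ ≤ ∑ i, (ENNReal.ofReal (1 / ξ) + ENNReal.ofReal (1 / (4 * N / v)) * depth G A i) :=
        Finset.sum_le_sum fun i _ => h i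
    _ = _ := by
        rw [Finset.sum_add_distrib, ← Finset.mul_sum, totalDepth, if_pos hG]
        simp

/-- Exchangeability bounds the expected average error bound given connectivity. -/
lemma expectedAverageASEB_le (R : Set Plane) [IsProbabilityMeasure (volume[|R])] (hn : 0 < n)
    (Rmax : ℝ) {N : ℕ} (hN : 0 < N) {v : ℝ≥0} (hv : v ≠ 0)
    (prior : Fin n → Option PriorDensity) (θ₀ : Fin n → ℝ) {ξ : ℝ} (hξ : 0 < ξ)
    (hprior : ∀ k, ∀ f ∈ prior k, ξ ≤ f.information) (hpos : 0 < numPrior prior) :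
    expectedAverageASEB n R Rmax N v prior θ₀ ≤
      ENNReal.ofReal (1 / ξ) + ENNReal.ofReal (1 / (4 * N / v)) * (n / numPrior prior) := by
  set μ := binomialProcess n R with hμ
  have : IsProbabilityMeasure μ := by rw [hμ, binomialProcess]; infer_instance
  set C := {p : Fin n → Plane | (commGraph Rmax p).Connected} with hC
  have hCm : MeasurableSet C := measurableSet_connected Rmax
  set k := numPrior prior with hk
  set A := Finset.univ.filter fun k => (prior k).isSome with hA
  have hn0 : (n : ℝ≥0∞) ≠ 0 := by exact_mod_cast hn.ne'
  have hk0 : (k : ℝ≥0∞) ≠ 0 := by exact_mod_cast hpos.ne'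
  set a := ENNReal.ofReal (1 / ξ)
  set b := ENNReal.ofReal (1 / (4 * N / v))
  have hdepth : ∫⁻ p in C, totalDepth (commGraph Rmax p) A ∂μ ≤ n * n / k * μ C := by
    have h := card_mul_lintegral_totalDepth_le (volume[|R]) Rmax A
    rw [div_eq_mul_inv]
    calc _ ≤ ∫⁻ p, totalDepth (commGraph Rmax p) A ∂μ := setLIntegral_le_lintegral _ _
      _ = (k : ℝ≥0∞)⁻¹ * (k * ∫⁻ p, totalDepth (commGraph Rmax p) A ∂μ) := by
          rw [← mul_assoc, ENNReal.inv_mul_cancel hk0 (ENNReal.natCast_ne_top _), one_mul]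
      _ ≤ (k : ℝ≥0∞)⁻¹ * (n * n * μ C) := mul_le_mul_right h _
      _ = _ := by ring
  have hint : ∫⁻ p in C, (∑ i, aseb (fim (commGraph Rmax p) N v prior θ₀) i) / n ∂μ ≤
      (a + b * (n / k)) * μ C := by
    calc _ ≤ ∫⁻ p in C, (a + b / n * totalDepth (commGraph Rmax p) A) ∂μ := by
          refine setLIntegral_mono' hCm fun p hp => ?_
          rw [ENNReal.div_le_iff hn0 (ENNReal.natCast_ne_top _)]
          refine (sum_aseb_le hp hN hv prior θ₀ hξ hprior hpos).trans (le_of_eq ?_)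
          rw [add_mul, mul_comm a, mul_right_comm,
            ENNReal.div_mul_cancel hn0 (ENNReal.natCast_ne_top _)]
      _ = a * μ C + b / n * ∫⁻ p in C, totalDepth (commGraph Rmax p) A ∂μ := by
          rw [lintegral_add_left measurable_const, setLIntegral_const, lintegral_const_mul _
            (measurable_comp_commGraph Rmax fun G => totalDepth G A)]
      _ ≤ a * μ C + b / n * (n * n / k * μ C) := by gcongr
      _ = a * μ C + b * (n / n) * (n / k) * μ C := by simp only [div_eq_mul_inv]; ring
      _ = _ := by rw [ENNReal.div_self hn0 (ENNReal.natCast_ne_top _)]; ring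
  rw [expectedAverageASEB, ProbabilityTheory.cond, lintegral_smul_measure, smul_eq_mul]
  -- The bound carries the factor μ C, so the conditioning cancels however small this probability
  -- is.
  calc _ ≤ (μ C)⁻¹ * ((a + b * (n / k)) * μ C) := by gcongr
    _ = (a + b * (n / k)) * ((μ C)⁻¹ * μ C) := by ring
    _ ≤ (a + b * (n / k)) * 1 := by gcongr; exact ENNReal.inv_mul_le_one _
    _ = _ := mul_one _

end Symmetrization

/-! ### An exponential lower bound for the probability of connectivity. -/

section Connectivity

variable {n : ℕ}

lemma connected_of_parent {G : SimpleGraph (Fin n)} (hn : 0 < n)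
    (h : ∀ j : Fin n, 0 < j.val → ∃ i < j, G.Adj i j) : G.Connected := by
  have hreach : ∀ (m : ℕ) (hm : m < n), G.Reachable ⟨0, hn⟩ ⟨m, hm⟩ := by
    intro m
    induction m using Nat.strong_induction_on with
    | _ m ih =>
      intro hm
      rcases Nat.eq_zero_or_pos m with rfl | hpos
      · exact SimpleGraph.Reachable.refl _
      · obtain ⟨i, hi, hadj⟩ := h ⟨m, hm⟩ hpos
        exact (ih i.val hi i.isLt).trans hadj.reachable
  have : Nonempty (Fin n) := ⟨⟨0, hn⟩⟩
  exact ⟨fun u w => (hreach u.val u.isLt).symm.trans (hreach w.val w.isLt)⟩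

lemma connected_comp_perm {Rmax : ℝ} {p : Fin n → Plane} (σ : Equiv.Perm (Fin n))
    (h : (commGraph Rmax (p ∘ σ)).Connected) : (commGraph Rmax p).Connected := by
  rw [commGraph_comp] at h
  exact (SimpleGraph.Iso.comap σ _).connected_iff.1 h

/-- If one agent in each of `n` disjoint discs makes the network connected, then the probability
of connectivity is at least the probability of this event. -/
lemma factorial_mul_pow_le_measure_connected (ν : Measure Plane) [IsProbabilityMeasure ν]
    {Rmax r : ℝ} {q : Fin n → Plane} {β : ℝ≥0∞} (hβ : ∀ j, β ≤ ν (Metric.ball (q j) r))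
    (hdisj : ∀ i j, i ≠ j → Disjoint (Metric.ball (q i) r) (Metric.ball (q j) r))
    (hconn : ∀ p : Fin n → Plane, (∀ j, p j ∈ Metric.ball (q j) r) →
      (commGraph Rmax p).Connected) :
    (n.factorial : ℝ≥0∞) * β ^ n ≤
      (Measure.pi fun _ : Fin n => ν) {p | (commGraph Rmax p).Connected} := by
  set μ := Measure.pi fun _ : Fin n => ν
  set E : Equiv.Perm (Fin n) → Set (Fin n → Plane) := fun σ =>
    Set.univ.pi fun i => Metric.ball (q (σ i)) r with hE
  have hEm : ∀ σ, MeasurableSet (E σ) := fun σ =>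
    MeasurableSet.univ_pi fun i => measurableSet_ball
  have hEμ : ∀ σ, β ^ n ≤ μ (E σ) := fun σ => by
    rw [Measure.pi_pi]
    calc β ^ n = ∏ _i : Fin n, β := by simp
      _ ≤ _ := Finset.prod_le_prod' fun i _ => hβ (σ i)
  -- Different assignments of agents to discs exclude each other. The resulting factor n! offsets
  -- the n^n lost because each disc has probability of order 1/n.
  have hEdisj : Pairwise (Function.onFun Disjoint E) := by
    intro σ τ hστ
    obtain ⟨i, hi⟩ : ∃ i, σ i ≠ τ i := by
      by_contra h
      push Not at h
      exact hστ (Equiv.ext h)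
    refine Set.disjoint_left.2 fun p hp hp' => ?_
    exact Set.disjoint_left.1 (hdisj _ _ hi) (hp i trivial) (hp' i trivial)
  have hsub : ⋃ σ, E σ ⊆ {p | (commGraph Rmax p).Connected} := by
    refine Set.iUnion_subset fun σ p hp => ?_
    refine connected_comp_perm σ.symm (hconn _ fun j => ?_)
    have := hp (σ.symm j) trivial
    simpa using this
  calc (n.factorial : ℝ≥0∞) * β ^ n = ∑ _σ : Equiv.Perm (Fin n), β ^ n := by
        simp [Fintype.card_perm]
    _ ≤ ∑ σ, μ (E σ) := Finset.sum_le_sum fun σ _ => hEμ σ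
    _ = μ (⋃ σ, E σ) := by rw [measure_iUnion hEdisj hEm, tsum_fintype]
    _ ≤ _ := measure_mono hsub

lemma abs_coord_le_dist (x y : Plane) (k : Fin 2) : |x k - y k| ≤ dist x y := by
  rw [dist_eq_norm, ← Real.norm_eq_abs]
  exact PiLp.norm_apply_le (x - y) k

lemma dist_le_abs_add_abs (x y : Plane) : dist x y ≤ |x 0 - y 0| + |x 1 - y 1| := by
  rw [EuclideanSpace.dist_eq, Fin.sum_univ_two, Real.dist_eq, Real.dist_eq]
  refine Real.sqrt_le_iff.2 ⟨by positivity, ?_⟩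
  nlinarith [abs_nonneg (x 0 - y 0), abs_nonneg (x 1 - y 1)]

/-- The first `n` points of a square grid with mesh size `a`. -/
lemma exists_grid (x : Plane) {a : ℝ} (ha : 0 < a) (n : ℕ) :
    ∃ q : Fin n → Plane, (∀ i j, i ≠ j → a ≤ dist (q i) (q j)) ∧
      (∀ j, dist (q j) x ≤ 2 * a * √n) ∧
      ∀ j : Fin n, 0 < j.val → ∃ i < j, dist (q i) (q j) ≤ a := by
  -- Row length: m² > n, so both coordinates of the first n grid points are at most √n mesh steps.
  set m := Nat.sqrt n + 1 with hm
  have hmpos : 0 < m := Nat.succ_pos _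
  set g : ℕ → Plane := fun j => x + !₂[a * ((j / m : ℕ) : ℝ), a * ((j % m : ℕ) : ℝ)] with hg
  have hg0 : ∀ j, g j 0 = x 0 + a * ((j / m : ℕ) : ℝ) := fun j => by simp [hg]
  have hg1 : ∀ j, g j 1 = x 1 + a * ((j % m : ℕ) : ℝ) := fun j => by simp [hg]
  have hsep : ∀ s t : ℕ, s ≠ t → 1 ≤ |(s : ℝ) - t| := fun s t hst => by
    have h1 : (s : ℤ) - t ≠ 0 := sub_ne_zero.2 (by exact_mod_cast hst)
    have h2 := Int.one_le_abs h1
    exact_mod_cast h2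
  refine ⟨fun j => g j, fun i j hij => ?_, fun j => ?_, fun j hj => ?_⟩
  · have hne : i.val / m ≠ j.val / m ∨ i.val % m ≠ j.val % m := by
      by_contra h
      push Not at h
      exact hij (Fin.ext (by rw [← Nat.div_add_mod i.val m, ← Nat.div_add_mod j.val m, h.1, h.2]))
    rcases hne with h | h
    · refine le_trans ?_ (abs_coord_le_dist _ _ 0)
      rw [hg0, hg0, add_sub_add_left_eq_sub, ← mul_sub, abs_mul, abs_of_pos ha]
      exact le_mul_of_one_le_right ha.le (hsep _ _ h)
    · refine le_trans ?_ (abs_coord_le_dist _ _ 1)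
      rw [hg1, hg1, add_sub_add_left_eq_sub, ← mul_sub, abs_mul, abs_of_pos ha]
      exact le_mul_of_one_le_right ha.le (hsep _ _ h)
  · have hsq : ((Nat.sqrt n : ℕ) : ℝ) ≤ √n := Real.nat_sqrt_le_real_sqrt
    have hdiv : j.val / m ≤ Nat.sqrt n := by
      rw [← Nat.lt_succ_iff]
      refine Nat.div_lt_of_lt_mul (j.isLt.trans ?_)
      exact Nat.lt_succ_sqrt n
    have hmod : j.val % m ≤ Nat.sqrt n := Nat.lt_succ_iff.1 (Nat.mod_lt _ hmpos)
    have hdiv' : ((j.val / m : ℕ) : ℝ) ≤ √n := (Nat.cast_le.2 hdiv).trans hsq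
    have hmod' : ((j.val % m : ℕ) : ℝ) ≤ √n := (Nat.cast_le.2 hmod).trans hsq
    refine (dist_le_abs_add_abs _ _).trans ?_
    rw [hg0, hg1, add_sub_cancel_left, add_sub_cancel_left, abs_of_nonneg (by positivity),
      abs_of_nonneg (by positivity)]
    nlinarith
  -- At the start of a row the earlier neighbour is j - m, the start of the previous row; elsewhere
  -- it is j - 1.
  · rcases Nat.eq_zero_or_pos (j.val % m) with h | h
    · have hle : m ≤ j.val := Nat.le_of_dvd hj (Nat.dvd_of_mod_eq_zero h)
      refine ⟨⟨j.val - m, by omega⟩, by rw [Fin.lt_def]; simp only; omega, ?_⟩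
      refine (dist_le_abs_add_abs _ _).trans ?_
      have h1 : (j.val - m) / m + 1 = j.val / m := by
        rw [Nat.div_eq_sub_div hmpos hle]
      have h2 : (j.val - m) % m = j.val % m := (Nat.mod_eq_sub_mod hle).symm
      rw [hg0, hg0, hg1, hg1, h2, ← h1]
      push_cast
      rw [sub_self, abs_zero, add_zero]
      apply le_of_eq
      rw [show x.ofLp 0 + a * (((j.val - m) / m : ℕ) : ℝ) -
        (x.ofLp 0 + a * ((((j.val - m) / m : ℕ) : ℝ) + 1)) = -a by ring, abs_neg, abs_of_pos ha]
    · refine ⟨⟨j.val - 1, by omega⟩, by rw [Fin.lt_def]; simp only; omega, ?_⟩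
      refine (dist_le_abs_add_abs _ _).trans ?_
      have hj1 := Nat.div_add_mod j.val m
      have hlt := Nat.mod_lt j.val hmpos
      have hdm := (Nat.div_mod_unique (a := j.val - 1) (b := m) (c := j.val % m - 1)
        (d := j.val / m) hmpos).2 ⟨by omega, by omega⟩
      have h2 : (j.val - 1) % m + 1 = j.val % m := by rw [hdm.2]; omega
      rw [hg0, hg0, hg1, hg1, hdm.1, ← h2]
      push_cast
      rw [sub_self, abs_zero, zero_add]
      apply le_of_eq
      rw [show x.ofLp 1 + a * (((j.val - 1) % m : ℕ) : ℝ) -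
        (x.ofLp 1 + a * ((((j.val - 1) % m : ℕ) : ℝ) + 1)) = -a by ring, abs_neg, abs_of_pos ha]

lemma cond_ball_le {R : Set Plane} {lam : ℝ} (hlam : 0 < lam) (hR : MeasurableSet R) (hn : 0 < n)
    (hvol : volume R = ENNReal.ofReal (n / lam)) (x : Plane) {r : ℝ} (hr : 0 ≤ r) :
    volume[|R] (Metric.ball x r) ≤ ENNReal.ofReal (Real.pi * r ^ 2 * lam / n) := by
  have hn' : (0 : ℝ) < n := by exact_mod_cast hn
  rw [cond_apply hR, hvol, ← ENNReal.ofReal_inv_of_pos (by positivity)]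
  calc _ ≤ ENNReal.ofReal (n / lam)⁻¹ * volume (Metric.ball x r) := by
        gcongr; exact Set.inter_subset_right
    _ = _ := by
        rw [EuclideanSpace.volume_ball_fin_two, ← ENNReal.ofReal_pow hr,
          ← ENNReal.ofReal_mul (by positivity), ← ENNReal.ofReal_mul (by positivity)]
        congr 1
        field_simp

lemma cond_ball_eq {R : Set Plane} {lam : ℝ} (hlam : 0 < lam) (hR : MeasurableSet R) (hn : 0 < n)
    (hvol : volume R = ENNReal.ofReal (n / lam)) {x : Plane} {r : ℝ} (hr : 0 ≤ r)
    (hsub : Metric.ball x r ⊆ R) :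
    volume[|R] (Metric.ball x r) = ENNReal.ofReal (Real.pi * r ^ 2 * lam / n) := by
  have hn' : (0 : ℝ) < n := by exact_mod_cast hn
  rw [cond_apply hR, hvol, ← ENNReal.ofReal_inv_of_pos (by positivity),
    Set.inter_eq_self_of_subset_right hsub, EuclideanSpace.volume_ball_fin_two,
    ← ENNReal.ofReal_pow hr, 
    ← ENNReal.ofReal_mul (by positivity), ← ENNReal.ofReal_mul (by positivity)]
  congr 1
  field_simp

/-- The probability of connectivity decays at most exponentially in the number of agents. -/
lemma exists_pow_le_measure_connected {lam Rmax c : ℝ} (hlam : 0 < lam) (hRmax : 0 < Rmax)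
    (hc : 0 < c) : ∃ δ : ℝ, 0 < δ ∧ ∀ (n : ℕ) (R : Set Plane), 0 < n → MeasurableSet R →
      volume R = ENNReal.ofReal (n / lam) → (∃ x, Metric.ball x (c * √n) ⊆ R) →
      ENNReal.ofReal (δ ^ n) ≤ binomialProcess n R {p | (commGraph Rmax p).Connected} := by
  -- With r = a/4: 2a√n + r ≤ 3a√n ≤ c√n keeps the discs inside the region, 2r ≤ a makes them
  -- disjoint, and a + 2r ≤ Rmax links agents in adjacent discs.
  set a := min (c / 3) (Rmax / 2) with ha_def
  have ha : 0 < a := by positivity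
  have hac : a ≤ c / 3 := min_le_left _ _
  have haR : a ≤ Rmax / 2 := min_le_right _ _
  set r := a / 4 with hr_def
  have hr : 0 < r := by positivity
  refine ⟨Real.pi * r ^ 2 * lam / Real.exp 1, by positivity, ?_⟩
  rintro n R hn hR hvol ⟨x, hx⟩
  have hn' : (0 : ℝ) < n := by exact_mod_cast hn
  have hn1 : (1 : ℝ) ≤ √n := Real.one_le_sqrt.2 (by exact_mod_cast hn)
  have hprob : IsProbabilityMeasure (volume[|R]) :=
    cond_isProbabilityMeasure_of_finite (by rw [hvol]; simp [hlam, hn])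
      (by rw [hvol]; exact ENNReal.ofReal_ne_top)
  obtain ⟨q, hsep, hq, hpar⟩ := exists_grid x ha n
  have hball : ∀ j, Metric.ball (q j) r ⊆ R := fun j =>
    (Metric.ball_subset_ball' (by have := hq j; nlinarith)).trans hx
  have hmain := factorial_mul_pow_le_measure_connected (volume[|R]) (Rmax := Rmax)
    (fun j => (cond_ball_eq hlam hR hn hvol hr.le (hball j)).ge)
    (fun i j hij => Metric.ball_disjoint_ball (by have := hsep i j hij; linarith))
    (fun p hp => connected_of_parent hn fun j hj => by
      obtain ⟨i, hij, hd⟩ := hpar j hj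
      refine ⟨i, hij, (commGraph_adj _ _ _ _).2 ⟨hij.ne, ?_⟩⟩
      have h1 := hp i
      have h2 := hp j
      rw [Metric.mem_ball] at h1 h2
      have h3 := dist_triangle4 (p i) (q i) (q j) (p j)
      rw [dist_comm (q j) (p j)] at h3
      linarith)
  refine le_trans ?_ hmain
  rw [← ENNReal.ofReal_pow (by positivity), ← ENNReal.ofReal_natCast,
    ← ENNReal.ofReal_mul (by positivity)]
  refine ENNReal.ofReal_le_ofReal ?_
  -- n! ≥ (n/e)^n turns n!(πr²λ/n)^n into the n-th power of a constant.
  have hfac := Real.pow_div_factorial_le_exp (n : ℝ) hn'.le n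
  have hfpos : (0 : ℝ) < n.factorial := by exact_mod_cast n.factorial_pos
  rw [div_le_iff₀ hfpos] at hfac
  rw [div_pow (_ * lam), div_pow (_ * lam), ← Real.exp_nat_mul, mul_one, ← mul_div_assoc,
    div_le_div_iff₀ (Real.exp_pos _) (by positivity)]
  calc _ ≤ (Real.pi * r ^ 2 * lam) ^ n * (Real.exp n * n.factorial) := by gcongr
    _ = _ := by ring

end Connectivity

/-! ### Crowding is exponentially unlikely. -/

section Followers

open scoped Classical

/-- A point is a follower if it is `ε`-close to a point with a smaller index. -/
def IsFollower {n : ℕ} (ε : ℝ) (p : Fin n → Plane) (i : Fin n) : Prop :=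
  ∃ j < i, dist (p i) (p j) < ε

/-- The weight `(1 + t)^k` of a configuration with `k` followers. -/
def followerWeight {n : ℕ} (ε : ℝ) (t : ℝ≥0∞) (p : Fin n → Plane) : ℝ≥0∞ :=
  ∏ i, (1 + if IsFollower ε p i then t else 0)

lemma measurableSet_isFollower {n : ℕ} (ε : ℝ) (i : Fin n) :
    MeasurableSet {p : Fin n → Plane | IsFollower ε p i} := by
  have : {p : Fin n → Plane | IsFollower ε p i} =
      ⋃ j, ⋃ (_ : j < i), {p | dist (p i) (p j) < ε} := by
    ext p; simp [IsFollower]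
  rw [this]
  exact MeasurableSet.iUnion fun j => MeasurableSet.iUnion fun _ =>
    measurableSet_lt (by fun_prop) measurable_const

lemma measurable_followerWeight {n : ℕ} (ε : ℝ) (t : ℝ≥0∞) :
    Measurable (followerWeight (n := n) ε t) :=
  Finset.measurable_prod _ fun i _ =>
    (Measurable.ite (measurableSet_isFollower ε i) measurable_const measurable_const).const_add 1

/-- Being a follower depends only on earlier points, so the weight can be integrated one point at a
time, the last point first. -/
lemma followerWeight_succ {n : ℕ} (ε : ℝ) (t : ℝ≥0∞) (p : Fin (n + 1) → Plane) :
    followerWeight ε t p = followerWeight ε t (fun j : Fin n => p j.castSucc) *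
      (1 + if ∃ j : Fin n, dist (p (Fin.last n)) (p j.castSucc) < ε then t else 0) := by
  rw [followerWeight, Fin.prod_univ_castSucc, followerWeight]
  congr 1
  · refine Finset.prod_congr rfl fun i _ => ?_
    have : IsFollower ε p i.castSucc ↔ IsFollower ε (fun j : Fin n => p j.castSucc) i := by
      constructor
      · rintro ⟨j, hj, hd⟩
        have hj' : j.val < n := lt_trans hj i.isLt
        exact ⟨⟨j.val, hj'⟩, hj, hd⟩
      · rintro ⟨j, hj, hd⟩
        exact ⟨j.castSucc, hj, hd⟩
    simp only [this]
  · have : IsFollower ε p (Fin.last n) ↔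
        ∃ j : Fin n, dist (p (Fin.last n)) (p j.castSucc) < ε := by
      constructor
      · rintro ⟨j, hj, hd⟩
        exact ⟨⟨j.val, hj⟩, hd⟩
      · rintro ⟨j, hd⟩
        exact ⟨j.castSucc, Fin.castSucc_lt_last j, hd⟩
    simp only [this]

/-- Given the earlier points, at most M of them, the next one is a follower with probability at most
Mβ by the union bound. The fixed M makes the factor the same at each step of the induction. -/
lemma lintegral_followerWeight_le (ν : Measure Plane) [IsProbabilityMeasure ν] {ε : ℝ}
    {β t : ℝ≥0∞} (hβ : ∀ x, ν (Metric.ball x ε) ≤ β) {M : ℕ} (n : ℕ) (hn : n ≤ M) :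
    ∫⁻ p, followerWeight ε t p ∂(Measure.pi fun _ : Fin n => ν) ≤ (1 + t * (M * β)) ^ n := by
  induction n with
  | zero => simp [followerWeight]
  | succ n ih =>
    set g : Plane × (Fin n → Plane) → ℝ≥0∞ := fun z =>
      followerWeight ε t z.2 * (1 + if ∃ j : Fin n, dist z.1 (z.2 j) < ε then t else 0) with hg
    have hset : MeasurableSet {z : Plane × (Fin n → Plane) | ∃ j : Fin n, dist z.1 (z.2 j) < ε} := by
      rw [Set.ofPred_exists]
      exact MeasurableSet.iUnion fun j => measurableSet_lt (by fun_prop) measurable_const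
    have hgm : Measurable g :=
      ((measurable_followerWeight ε t).comp measurable_snd).mul
        ((Measurable.ite hset measurable_const measurable_const).const_add 1)
    have hpres := measurePreserving_piFinSuccAbove (fun _ : Fin (n + 1) => ν) (Fin.last n)
    have heq : ∀ p : Fin (n + 1) → Plane, followerWeight ε t p =
        g (MeasurableEquiv.piFinSuccAbove (fun _ => Plane) (Fin.last n) p) := fun p => by
      rw [followerWeight_succ, hg]
      simp [MeasurableEquiv.piFinSuccAbove, Fin.insertNthEquiv]
      rfl
    have hinner : ∀ p' : Fin n → Plane, ∫⁻ y, g (y, p') ∂ν ≤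
        followerWeight ε t p' * (1 + t * (M * β)) := by
      intro p'
      have hs : {y : Plane | ∃ j : Fin n, dist y (p' j) < ε} =
          ⋃ j : Fin n, Metric.ball (p' j) ε := by
        ext y; simp
      have hsm : MeasurableSet {y : Plane | ∃ j : Fin n, dist y (p' j) < ε} := by
        rw [hs]; exact MeasurableSet.iUnion fun j => measurableSet_ball
      have hsν : ν {y : Plane | ∃ j : Fin n, dist y (p' j) < ε} ≤ M * β := by
        rw [hs]
        calc _ ≤ ∑ j : Fin n, ν (Metric.ball (p' j) ε) := measure_iUnion_fintype_le _ _
          _ ≤ ∑ _j : Fin n, β := Finset.sum_le_sum fun j _ => hβ _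
          _ = n * β := by simp
          _ ≤ M * β := by gcongr; omega
      have hind : ∀ y, (if ∃ j : Fin n, dist y (p' j) < ε then t else 0) =
          {y : Plane | ∃ j : Fin n, dist y (p' j) < ε}.indicator (fun _ => t) y := fun y => by
        simp [Set.indicator_apply]
      simp only [hg, hind]
      rw [lintegral_const_mul _ ((measurable_const.indicator hsm).const_add 1),
        lintegral_add_left measurable_const, lintegral_indicator_const hsm, lintegral_one,
        measure_univ]
      gcongr
    simp_rw [heq]
    rw [hpres.lintegral_comp hgm, lintegral_prod_symm _ hgm.aemeasurable]
    calc _ ≤ ∫⁻ p', followerWeight ε t p' * (1 + t * (M * β)) ∂(Measure.pi fun _ : Fin n => ν) :=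
          lintegral_mono hinner
      _ = (∫⁻ p', followerWeight ε t p' ∂(Measure.pi fun _ : Fin n => ν)) * (1 + t * (M * β)) :=
          lintegral_mul_const _ (measurable_followerWeight ε t)
      _ ≤ (1 + t * (M * β)) ^ n * (1 + t * (M * β)) := by gcongr; exact ih (by omega)
      _ = _ := (pow_succ _ _).symm

/-- The followers of a configuration. -/
def followers {n : ℕ} (ε : ℝ) (p : Fin n → Plane) : Finset (Fin n) :=
  Finset.univ.filter fun i => IsFollower ε p i

lemma mem_followers {n : ℕ} {ε : ℝ} {p : Fin n → Plane} {i : Fin n} :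
    i ∈ followers ε p ↔ IsFollower ε p i := by
  simp [followers]

lemma followerWeight_eq_pow {n : ℕ} (ε : ℝ) (t : ℝ≥0∞) (p : Fin n → Plane) :
    followerWeight ε t p = (1 + t) ^ (followers ε p).card := by
  rw [followerWeight, followers, ← Finset.prod_const, Finset.prod_filter]
  refine Finset.prod_congr rfl fun i _ => ?_
  split_ifs <;> simp

/-- A Chernoff bound with t = s²: on the event the weight is at least s^n, while its mean is at most
2^n. -/
lemma measure_followers_le (ν : Measure Plane) [IsProbabilityMeasure ν] {ε s : ℝ} (hs : 1 ≤ s)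
    {β : ℝ≥0∞} (hβ : ∀ x, ν (Metric.ball x ε) ≤ β) {n : ℕ}
    (hsβ : ENNReal.ofReal (s ^ 2) * (n * β) ≤ 1) :
    (Measure.pi fun _ : Fin n => ν) {p | n ≤ 2 * (followers ε p).card} ≤
      ENNReal.ofReal ((2 / s) ^ n) := by
  have hs0 : 0 < s := by linarith
  set t := ENNReal.ofReal (s ^ 2)
  set b := ENNReal.ofReal s ^ n with hb
  have hb0 : b ≠ 0 := pow_ne_zero _ (ENNReal.ofReal_pos.2 hs0).ne'
  have hbt : b ≠ ⊤ := ENNReal.pow_ne_top ENNReal.ofReal_ne_top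
  have hsub : {p : Fin n → Plane | n ≤ 2 * (followers ε p).card} ⊆
      {p | b ≤ followerWeight ε t p} := by
    intro p hp
    simp only [Set.mem_ofPred_eq] at hp ⊢
    rw [followerWeight_eq_pow]
    calc b ≤ ENNReal.ofReal s ^ (2 * (followers ε p).card) :=
          pow_le_pow_right₀ (by rw [← ENNReal.ofReal_one]; exact ENNReal.ofReal_le_ofReal hs) hp
      _ = t ^ (followers ε p).card := by rw [pow_mul, ← ENNReal.ofReal_pow hs0.le]
      _ ≤ _ := by gcongr; exact le_add_self
  calc _ ≤ (Measure.pi fun _ : Fin n => ν) {p | b ≤ followerWeight ε t p} := measure_mono hsub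
    _ ≤ (∫⁻ p, followerWeight ε t p ∂(Measure.pi fun _ : Fin n => ν)) / b :=
        meas_ge_le_lintegral_div (measurable_followerWeight ε t).aemeasurable hb0 hbt
    _ ≤ (1 + 1) ^ n / b := by
        gcongr
        refine (lintegral_followerWeight_le ν (t := t) hβ n le_rfl).trans ?_
        gcongr
    _ = _ := by
        rw [hb, ← ENNReal.ofReal_pow hs0.le, div_pow, ENNReal.ofReal_div_of_pos (by positivity),
          ENNReal.ofReal_pow (p := 2) (by norm_num)]
        norm_num

end Followers

/-! ### Packing and the lower bound. -/

section Packing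

/-- After translation to the origin, a finite cover by balls of radius ε/2 has at most one point of
the family in each ball; K is the size of the cover, independent of the centre. -/
lemma exists_packing_bound (r : ℝ) {ε : ℝ} (hε : 0 < ε) : ∃ K : ℕ, ∀ {ι : Type} (L : Finset ι)
    (p : ι → Plane) (x : Plane), (∀ i ∈ L, dist (p i) x ≤ r) →
    (∀ i ∈ L, ∀ j ∈ L, i ≠ j → ε ≤ dist (p i) (p j)) → L.card ≤ K := by
  obtain ⟨T, hT, hcov⟩ := Metric.totallyBounded_iff.1
    (isCompact_closedBall (0 : Plane) r).totallyBounded (ε / 2) (by positivity)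
  refine ⟨hT.toFinset.card, fun L p x hr hsep => ?_⟩
  have h : ∀ i ∈ L, ∃ y ∈ hT.toFinset, dist (p i - x) y < ε / 2 := fun i hi => by
    have : p i - x ∈ Metric.closedBall (0 : Plane) r := by
      rw [Metric.mem_closedBall, dist_zero_right, ← dist_eq_norm]
      exact hr i hi
    simpa using hcov this
  choose! f hfT hfd using h
  refine Finset.card_le_card_of_injOn f hfT fun i hi j hj hij => ?_
  by_contra hne
  have h1 := hfd i hi
  have h2 := hfd j hj
  rw [← hij] at h2
  have h3 := dist_triangle_right (p i - x) (p j - x) (f i)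
  rw [dist_sub_right] at h3
  linarith [hsep i hi j hj hne]

open scoped Classical in
/-- If at most half of the agents are followers, then the average error bound is bounded away
from zero. -/
lemma le_sum_aseb_of_followers {Rmax ε : ℝ} {K : ℕ}
    (hK : ∀ {ι : Type} (L : Finset ι) (p : ι → Plane) (x : Plane),
      (∀ i ∈ L, dist (p i) x ≤ Rmax) →
      (∀ i ∈ L, ∀ j ∈ L, i ≠ j → ε ≤ dist (p i) (p j)) → L.card ≤ K)
    {n : ℕ} (hn : 0 < n) {p : Fin n → Plane} (hp : 2 * (followers ε p).card < n)
    {N : ℕ} {v : ℝ≥0} (hv : v ≠ 0) (prior : Fin n → Option PriorDensity) (θ₀ : Fin n → ℝ)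
    (hprior : ∀ k, ∀ f ∈ prior k, f.information ≠ 0) {X : ℝ} (hX : 0 < X)
    (hXprior : ∀ k, priorInfo (prior k) ≤ X) :
    ENNReal.ofReal (1 / (4 * (X + 8 * N / v * K))) ≤
      (∑ i, aseb (fim (commGraph Rmax p) N v prior θ₀) i) / n := by
  have hn' : (0 : ℝ) < n := by exact_mod_cast hn
  set κ : ℝ := 8 * N / v with hκ
  have hκ0 : 0 ≤ κ := by positivity
  set L := (followers ε p)ᶜ with hL
  set G := commGraph Rmax p
  set deg : Fin n → ℝ := fun i => ∑ j, if G.Adj i j then 1 else 0 with hdeg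
  have hdeg0 : ∀ i, 0 ≤ deg i := fun i => Finset.sum_nonneg fun j _ => by split_ifs <;> norm_num
  have hcard : (n : ℝ) / 2 ≤ L.card := by
    have h1 : L.card + (followers ε p).card = n := by
      rw [hL, Finset.card_compl_add_card, Fintype.card_fin]
    have h2 : n ≤ 2 * L.card := by omega
    have h3 : (n : ℝ) ≤ 2 * L.card := by exact_mod_cast h2
    linarith
  have hsep : ∀ i ∈ L, ∀ j ∈ L, i ≠ j → ε ≤ dist (p i) (p j) := by
    intro i hi j hj hij
    simp only [hL, Finset.mem_compl, mem_followers, IsFollower, not_exists, not_and, not_lt] at hi hj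
    rcases lt_or_gt_of_ne hij with h | h
    · rw [dist_comm]; exact hj i h
    · exact hi j h
  -- A single degree may be large, since followers count as neighbours. Double counting bounds the
  -- sum: each agent has at most K neighbours in the separated set L.
  have hsumdeg : ∑ i ∈ L, deg i ≤ n * K := by
    rw [hdeg, Finset.sum_comm]
    calc ∑ j, ∑ i ∈ L, (if G.Adj i j then (1 : ℝ) else 0) ≤ ∑ _j : Fin n, (K : ℝ) := by
          refine Finset.sum_le_sum fun j _ => ?_
          rw [Finset.sum_boole]
          refine Nat.cast_le.2 (hK _ p (p j) (fun i hi => ?_) fun i hi k hk => ?_)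
          · exact ((commGraph_adj _ _ _ _).1 (Finset.mem_filter.1 hi).2).2
          · exact hsep i (Finset.mem_filter.1 hi).1 k (Finset.mem_filter.1 hk).1
      _ = _ := by simp
  have haseb : ∀ i, ENNReal.ofReal (1 / (X + κ * deg i)) ≤ aseb (fim G N v prior θ₀) i := by
    intro i
    refine le_aseb (fim_isSymm hv prior θ₀ hprior) (fun x => ?_) i ?_ ?_
    · rw [dotProduct_fim_mulVec hv prior θ₀ hprior]
      exact add_nonneg (Finset.sum_nonneg fun i _ =>
        mul_nonneg (priorInfo_nonneg _) (sq_nonneg _)) (mul_nonneg (by positivity)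
          (Finset.sum_nonneg fun d _ => sq_nonneg _))
    · have := mul_nonneg hκ0 (hdeg0 i); linarith
    · exact (fim_diag_le hv prior θ₀ hprior i).trans (by rw [hdeg]; gcongr; exact hXprior i)
  have hpos : ∀ i, 0 < X + κ * deg i := fun i => by
    have := mul_nonneg hκ0 (hdeg0 i); linarith
  have hLn : (L.card : ℝ) ≤ n := by
    exact_mod_cast (Finset.card_le_univ L).trans_eq (Fintype.card_fin n)
  have hLpos : (0 : ℝ) < L.card := by linarith
  -- Cauchy–Schwarz in the form |L|²/∑ ≤ ∑ of reciprocals; the 4 comes from |L| ≥ n/2.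
  have hreal : n / (4 * (X + κ * K)) ≤ ∑ i ∈ L, 1 / (X + κ * deg i) := by
    have hcs := Finset.sq_sum_div_le_sum_sq_div L (fun _ => (1 : ℝ)) fun i _ => hpos i
    simp only [one_pow, Finset.sum_const, nsmul_eq_mul, mul_one] at hcs
    refine le_trans ?_ hcs
    have hden : ∑ i ∈ L, (X + κ * deg i) ≤ n * (X + κ * K) := by
      rw [Finset.sum_add_distrib, ← Finset.mul_sum, Finset.sum_const, nsmul_eq_mul]
      calc _ ≤ n * X + κ * (n * K) := by gcongr
        _ = _ := by ring
    have hden0 : 0 < ∑ i ∈ L, (X + κ * deg i) :=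
      Finset.sum_pos (fun i _ => hpos i) (Finset.card_pos.1 (by exact_mod_cast hLpos))
    calc (n : ℝ) / (4 * (X + κ * K)) = (n / 2) ^ 2 / (n * (X + κ * K)) := by field_simp; norm_num
      _ ≤ (L.card : ℝ) ^ 2 / ∑ i ∈ L, (X + κ * deg i) := by gcongr
  rw [ENNReal.le_div_iff_mul_le (Or.inl (by exact_mod_cast hn.ne'))
    (Or.inl (ENNReal.natCast_ne_top _)), ← ENNReal.ofReal_natCast,
    ← ENNReal.ofReal_mul (by positivity)]
  calc _ = ENNReal.ofReal (n / (4 * (X + κ * K))) := by congr 1; ring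
    _ ≤ ENNReal.ofReal (∑ i ∈ L, 1 / (X + κ * deg i)) := ENNReal.ofReal_le_ofReal hreal
    _ = ∑ i ∈ L, ENNReal.ofReal (1 / (X + κ * deg i)) :=
        ENNReal.ofReal_sum_of_nonneg fun i _ => (one_div_pos.2 (hpos i)).le
    _ ≤ ∑ i ∈ L, aseb (fim G N v prior θ₀) i := Finset.sum_le_sum fun i _ => haseb i
    _ ≤ _ := Finset.sum_le_sum_of_subset (Finset.subset_univ _)

/-- The expected average error bound given connectivity is bounded away from zero. -/
lemma exists_le_expectedAverageASEB {lam Rmax c : ℝ} (hlam : 0 < lam) (hRmax : 0 < Rmax)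
    (hc : 0 < c) (N : ℕ) {v : ℝ≥0} (hv : v ≠ 0) {X : ℝ} (hX : 0 < X) :
    ∃ η : ℝ≥0∞, 0 < η ∧ ∀ (n : ℕ) (R : Set Plane) (prior : Fin n → Option PriorDensity)
      (θ₀ : Fin n → ℝ), 0 < n → MeasurableSet R → volume R = ENNReal.ofReal (n / lam) →
      (∃ x, Metric.ball x (c * √n) ⊆ R) → (∀ k, ∀ f ∈ prior k, f.information ≠ 0) →
      (∀ k, priorInfo (prior k) ≤ X) →
      η ≤ expectedAverageASEB n R Rmax N v prior θ₀ := by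
  obtain ⟨δ, hδ, hconn⟩ := exists_pow_le_measure_connected hlam hRmax hc
  -- Large enough that (2/s)^n ≤ (δ/2)^n: crowding is then rarer than connectivity.
  set s := 4 / δ + 1 with hs_def
  have hs1 : 1 ≤ s := by rw [hs_def]; have : 0 < 4 / δ := by positivity
                         linarith
  have hs0 : 0 < s := by linarith
  have hsδ : 2 / s ≤ δ / 2 := by
    rw [div_le_div_iff₀ hs0 two_pos, hs_def, mul_add, mul_div_cancel₀ _ hδ.ne']
    linarith
  -- Solves s² · πε²λ = 1, the hypothesis of `measure_followers_le`, because an ε-ball has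
  -- probability at most πε²λ/n.
  set ε := 1 / (s * √(Real.pi * lam)) with hε_def
  have hε : 0 < ε := by positivity
  have hsε : s ^ 2 * (Real.pi * ε ^ 2 * lam) = 1 := by
    have h1 : √(Real.pi * lam) ^ 2 = Real.pi * lam := Real.sq_sqrt (by positivity)
    rw [hε_def, div_pow, mul_pow, h1]
    field_simp
  obtain ⟨K, hK⟩ := exists_packing_bound Rmax hε
  set η := ENNReal.ofReal (1 / (4 * (X + 8 * N / v * K))) with hη
  have hη0 : 0 < η := by
    rw [hη, ENNReal.ofReal_pos]; positivity
  refine ⟨η * (1 / 2), by simp [hη0], ?_⟩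
  intro n R prior θ₀ hn hR hvol hdisc hprior hXprior
  have hn' : (0 : ℝ) < n := by exact_mod_cast hn
  have hprob : IsProbabilityMeasure (volume[|R]) :=
    cond_isProbabilityMeasure_of_finite (by rw [hvol]; simp [hlam, hn])
      (by rw [hvol]; exact ENNReal.ofReal_ne_top)
  set μ := binomialProcess n R with hμ
  have hμprob : IsProbabilityMeasure μ := by rw [hμ, binomialProcess]; infer_instance
  set C := {p : Fin n → Plane | (commGraph Rmax p).Connected} with hC
  have hCm : MeasurableSet C := measurableSet_connected Rmax
  set B := {p : Fin n → Plane | n ≤ 2 * (followers ε p).card} with hB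
  have hCδ : ENNReal.ofReal (δ ^ n) ≤ μ C := hconn n R hn hR hvol hdisc
  have hC0 : μ C ≠ 0 := (lt_of_lt_of_le (ENNReal.ofReal_pos.2 (by positivity)) hCδ).ne'
  -- Thus, even given connectivity, crowding has probability at most 1/2.
  have hBμ : μ B ≤ (1 / 2) * μ C := by
    have h := measure_followers_le (volume[|R]) hs1 (fun x => cond_ball_le hlam hR hn hvol x hε.le)
      (n := n) (by
        rw [← ENNReal.ofReal_natCast, ← ENNReal.ofReal_mul (by positivity),
          ← ENNReal.ofReal_mul (by positivity), mul_div_cancel₀ _ hn'.ne', hsε,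
          ENNReal.ofReal_one])
    refine h.trans (le_trans ?_ (mul_le_mul_right hCδ _))
    rw [show (1 / 2 : ℝ≥0∞) = ENNReal.ofReal (1 / 2) by
      rw [ENNReal.ofReal_div_of_pos two_pos]; simp, ← ENNReal.ofReal_mul (by norm_num)]
    refine ENNReal.ofReal_le_ofReal ?_
    calc (2 / s) ^ n ≤ (δ / 2) ^ n := by gcongr
      _ = (1 / 2) ^ n * δ ^ n := by rw [← mul_pow]; ring
      _ ≤ (1 / 2) ^ 1 * δ ^ n := by
          gcongr ?_ * _
          exact pow_le_pow_of_le_one (by norm_num) (by norm_num) hn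
      _ = _ := by ring
  have hcprob : IsProbabilityMeasure (μ[|C]) := cond_isProbabilityMeasure hC0
  have hcB : μ[|C] B ≤ 1 / 2 := by
    rw [cond_apply hCm]
    calc (μ C)⁻¹ * μ (C ∩ B) ≤ (μ C)⁻¹ * ((1 / 2) * μ C) := by
          gcongr; exact (measure_mono Set.inter_subset_right).trans hBμ
      _ = (1 / 2) * ((μ C)⁻¹ * μ C) := by ring
      _ ≤ (1 / 2) * 1 := by gcongr; exact ENNReal.inv_mul_le_one _
      _ = _ := mul_one _
  have hcBc : 1 / 2 ≤ μ[|C] Bᶜ := by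
    have h1 : (1 : ℝ≥0∞) ≤ μ[|C] B + μ[|C] Bᶜ := by
      rw [← measure_univ (μ := μ[|C]), ← Set.union_compl_self B]
      exact measure_union_le _ _
    have h2 : (1 : ℝ≥0∞) ≤ 1 / 2 + μ[|C] Bᶜ := h1.trans (by gcongr)
    have h3 : (1 / 2 : ℝ≥0∞) + 1 / 2 = 1 := ENNReal.add_halves 1
    exact (ENNReal.add_le_add_iff_left (a := 1 / 2) (by simp)).1 (h3.trans_le h2)
  have hBc : ∀ p ∈ Bᶜ, η ≤ (∑ i, aseb (fim (commGraph Rmax p) N v prior θ₀) i) / n := by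
    intro p hp
    simp only [hB, Set.mem_compl_iff, Set.mem_ofPred_eq, not_le] at hp
    exact le_sum_aseb_of_followers hK hn hp hv prior θ₀ hprior hX hXprior
  calc η * (1 / 2) ≤ η * μ[|C] Bᶜ := by gcongr
    _ = ∫⁻ _p in Bᶜ, η ∂μ[|C] := (setLIntegral_const _ _).symm
    _ ≤ ∫⁻ p in Bᶜ, (∑ i, aseb (fim (commGraph Rmax p) N v prior θ₀) i) / n ∂μ[|C] := by
        refine setLIntegral_mono (Measurable.div_const (measurable_comp_commGraph Rmax
          fun G => ∑ i, aseb (fim G N v prior θ₀) i) _) hBc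
    _ ≤ _ := setLIntegral_le_lintegral _ _

end Packing

end NetworkSync

end

/-! ### The two bounds combined. -/

theorem proposition6
    -- intensities of the agents and of the agents with a priori information,
    -- communication range, number of rounds, noise variance, bounds on the prior information
    (lam_a lam_ap Rmax : ℝ) (hlam_a : 0 < lam_a) (hlam_ap : 0 < lam_ap) (hRmax : 0 < Rmax)
    (N : ℕ) (hN : 0 < N) (v : ℝ≥0) (hv : 0 < v)
    (xi_min xi_max : ℝ) (hxi_min : 0 < xi_min)
    -- extended networks: the region of `n` agents has area `n / lam_a`, and it contains a disc
    -- whose area is at least a fixed fraction of this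
    (Rnet : ℕ → Set NetworkSync.Plane) (hRnet_meas : ∀ n, MeasurableSet (Rnet n))
    (hRnet_area : ∀ n, volume (Rnet n) = ENNReal.ofReal (n / lam_a))
    (hRnet_disc : ∃ c > 0, ∀ n : ℕ, ∃ x, Metric.ball x (c * √n) ⊆ Rnet n)
    -- priors of the agents (`none`: no a priori information), and fixed offsets of those without
    (prior : (n : ℕ) → Fin n → Option NetworkSync.PriorDensity) (θ₀ : (n : ℕ) → Fin n → ℝ)
    (hprior_intensity : Tendsto
      (fun n => ((Finset.univ.filter fun k => (prior n k).isSome).card : ℝ) /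
        volume.real (Rnet n)) atTop (𝓝 lam_ap))
    (hprior_info : ∀ n k, ∀ f ∈ prior n k, f.information ∈ Set.Icc xi_min xi_max) :
    0 < liminf (fun n =>
        NetworkSync.expectedAverageASEB n (Rnet n) Rmax N v (prior n) (θ₀ n)) atTop ∧
      limsup (fun n =>
        NetworkSync.expectedAverageASEB n (Rnet n) Rmax N v (prior n) (θ₀ n)) atTop < ⊤ := by
  obtain ⟨c, hc, hdisc⟩ := hRnet_disc
  have hinfo : ∀ n k, ∀ f ∈ prior n k, xi_min ≤ f.information := fun n k f hf =>
    (hprior_info n k f hf).1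
  have hinfo0 : ∀ n k, ∀ f ∈ prior n k, f.information ≠ 0 := fun n k f hf =>
    (hxi_min.trans_le (hinfo n k f hf)).ne'
  constructor
  -- The maximum with 1 supplies a positive bound without an appeal to the existence of an agent
  -- with a prior.
  · have hX : ∀ n k, NetworkSync.priorInfo (prior n k) ≤ max xi_max 1 := fun n k => by
      rcases h : prior n k with _ | f
      · exact zero_le_one.trans (le_max_right _ _)
      · exact (hprior_info n k f h).2.trans (le_max_left _ _)
    obtain ⟨η, hη, hle⟩ := NetworkSync.exists_le_expectedAverageASEB hlam_a hRmax hc N hv.ne'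
      (X := max xi_max 1) (zero_lt_one.trans_le (le_max_right _ _))
    refine hη.trans_le (le_liminf_of_le (by isBoundedDefault) ?_)
    filter_upwards [eventually_gt_atTop 0] with n hn
    exact hle n (Rnet n) (prior n) (θ₀ n) hn (hRnet_meas n) (hRnet_area n) (hdisc n) (hinfo0 n)
      (hX n)
  -- Half the limiting fraction of agents with a prior: eventually k > ρn, so n/k ≤ 1/ρ.
  · set ρ := lam_ap / 2 / lam_a with hρ
    have hρ0 : 0 < ρ := by positivity
    have hbound : ENNReal.ofReal (1 / xi_min) + ENNReal.ofReal (1 / (4 * N / v)) *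
        ENNReal.ofReal (1 / ρ) < ⊤ :=
      ENNReal.add_lt_top.2 ⟨ENNReal.ofReal_lt_top,
        ENNReal.mul_lt_top ENNReal.ofReal_lt_top ENNReal.ofReal_lt_top⟩
    refine lt_of_le_of_lt (limsup_le_of_le (by isBoundedDefault) ?_) hbound
    filter_upwards [eventually_gt_atTop 0, hprior_intensity.eventually_const_lt
      (half_lt_self hlam_ap)] with n hn hdens
    have hn' : (0 : ℝ) < n := by exact_mod_cast hn
    have hvol : volume.real (Rnet n) = n / lam_a := by
      rw [measureReal_def, hRnet_area, ENNReal.toReal_ofReal (by positivity)]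
    rw [hvol, lt_div_iff₀ (by positivity)] at hdens
    have hk : ρ * n < NetworkSync.numPrior (prior n) := by
      rw [NetworkSync.numPrior]
      refine lt_of_eq_of_lt ?_ hdens
      rw [hρ]; ring
    have hkpos : 0 < NetworkSync.numPrior (prior n) := by
      have : (0 : ℝ) < NetworkSync.numPrior (prior n) := lt_trans (by positivity) hk
      exact_mod_cast this
    have hprob : IsProbabilityMeasure (volume[|Rnet n]) :=
      cond_isProbabilityMeasure_of_finite (by rw [hRnet_area]; simp [hlam_a, hn])
        (by rw [hRnet_area]; exact ENNReal.ofReal_ne_top)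
    refine (NetworkSync.expectedAverageASEB_le (Rnet n) hn Rmax hN hv.ne' (prior n) (θ₀ n) hxi_min
      (hinfo n) hkpos).trans ?_
    gcongr
    rw [← ENNReal.ofReal_natCast, ← ENNReal.ofReal_natCast,
      ← ENNReal.ofReal_div_of_pos (by exact_mod_cast hkpos)]
    refine ENNReal.ofReal_le_ofReal ?_
    rw [div_le_div_iff₀ (by exact_mod_cast hkpos) hρ0]
    linarith
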